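/- A $3$-graph is a family of $3$-element subsets of a finite vertex set. For a graph $G$, let $G^+$ denote its expansion, the $3$-graph with edge set $\{e\cup\{v_e\} : e\in E(G)\}$, where the $v_e$ are distinct vertices not in $V(G)$. For a $3$-graph $F$, let $\mathrm{ex}_3(n,F)$ be the maximum number of edges in a $3$-graph on $n$ vertices that contains no copy of $F$. Fix an integer $r\ge 1$ and let $t=2r^2+1$. Then, as $n\to\infty$, $$(1-o(1))\,\frac{t-1}{12}\,n^2\;\le\;\mathrm{ex}_3(n,K_{3,t}^+)\;=\;O(n^2).$$ Here $K_{3,t}$ is the complete bipartite graph with parts of sizes $3$ and $t$, and the $o(1)$ and $O(\cdot)$ terms may depend on $r$. -/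

import Mathlib

open Filter Topology Asymptotics

/-- A hypergraph with vertex type `V` is given by its finite family of edges. The hypergraph `H`
contains a copy of `F` if some injection of the vertices of `F` into the vertices of `H` maps every
edge of `F` to an edge of `H`. -/
def ContainsCopy {W V : Type*} (F : Finset (Finset W)) (H : Finset (Finset V)) : Prop :=
  ∃ f : W ↪ V, ∀ e ∈ F, e.map f ∈ H

open Classical in
/-- The Turán number `ex_k(n, F)`: the maximum number of edges in a `k`-uniform hypergraph on `n`
vertices that does not contain a copy of `F`. -/
noncomputable def turanNumber {W : Type*} (k n : ℕ) (F : Finset (Finset W)) : ℕ :=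
  {H : Finset (Finset (Fin n)) | (H : Set (Finset (Fin n))).Sized k ∧
    ¬ ContainsCopy F H}.toFinset.sup Finset.card

open Classical in
/-- The expansion `G⁺` of a finite graph `G`: the vertices are those of `G` together with one new
vertex for each edge of `G`, and the edges are the sets `e ∪ {v_e}`, where `v_e` is the new vertex
of the edge `e` of `G`. -/
noncomputable def graphExpansion {V : Type*} [Fintype V] (G : SimpleGraph V) :
    Finset (Finset (V ⊕ G.edgeSet)) :=
  Finset.univ.image fun e : G.edgeSet => (e : Sym2 V).toFinset.disjSum {e}

/-! Upper bound: deleting at most d edges per shadow pair leaves a 3-graph in which every shadow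
pair has degree at least d (`exists_subset_full`). For a suitable constant d, a K_{3,t} in its
shadow graph would extend to the expansion (`containsCopy_graphExpansion`), so the shadow graph is
K_{3,t}-free. Such a graph has O(n^2) triangles by Cauchy–Schwarz (`sum_triangle_le`), and every
remaining edge is one of them.

Lower bound: take as edges the triangles of a K_{3,t}-free graph. The graph is a norm graph over the
field of p^2 elements, where r divides p - 1: (A, a) and (B, b) are joined when N(A + B)^r = ab,
with N(x) = x^(p+1). It has about p^3/r vertices, three vertices have at most 2r^2 = t - 1 common
neighbours (`NormVertex.card_common_le`), and there are about p^6 ordered triangles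
(`NormVertex.exists_triangles`). For n near p^3/r this gives about p^6/6 = r^2 n^2/6 = (t-1) n^2/12
edges.

To serve every large n one needs a prime p ≡ 1 mod r with p^3 just below rn, up to a factor 1 +
o(1). This follows from a Wiener–Ikehara type argument (`eventually_exists_abs_sub_log_le`): a Fejér
kernel of large parameter l smooths the Dirichlet series of the von Mangoldt function on a residue
class. The pole contributes a term growing with l, while terms with log n away from y contribute a
bounded amount, so some log p must lie near y. -/

/-! ### Fejér kernels and their pairing with Dirichlet series. -/

/-- The (unnormalised) Fejér kernel `(1 - cos (l * u)) / u ^ 2`, as a continuous function of `u`. -/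
noncomputable def fejerKernel (l u : ℝ) : ℝ := l ^ 2 / 2 * Real.sinc (l * u / 2) ^ 2

theorem fejerKernel_nonneg (l u : ℝ) : 0 ≤ fejerKernel l u := by
  unfold fejerKernel; positivity

theorem continuous_fejerKernel (l : ℝ) : Continuous (fejerKernel l) := by
  unfold fejerKernel
  have := Real.continuous_sinc
  fun_prop

theorem fejerKernel_le_const (l u : ℝ) : fejerKernel l u ≤ l ^ 2 / 2 := by
  unfold fejerKernel
  have h := (sq_le_one_iff_abs_le_one _).2 (Real.abs_sinc_le_one (l * u / 2))
  nlinarith [sq_nonneg l]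

theorem fejerKernel_of_ne_zero (l : ℝ) {u : ℝ} (hu : u ≠ 0) :
    fejerKernel l u = (1 - Real.cos (l * u)) / u ^ 2 := by
  unfold fejerKernel
  rcases eq_or_ne l 0 with rfl | hl
  · simp
  rw [Real.sinc_of_ne_zero (by positivity), show l * u = 2 * (l * u / 2) by ring, Real.cos_two_mul,
    ← Real.sin_sq_add_cos_sq (l * u / 2)]
  field_simp
  ring

theorem fejerKernel_le_div_sq (l : ℝ) {u : ℝ} (hu : u ≠ 0) : fejerKernel l u ≤ 2 / u ^ 2 := by
  rw [fejerKernel_of_ne_zero l hu]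
  gcongr
  linarith [Real.neg_one_le_cos (l * u)]

theorem le_fejerKernel {l u : ℝ} (hu : |l * u| ≤ 1) : l ^ 2 / 8 ≤ fejerKernel l u := by
  rcases eq_or_ne u 0 with rfl | hu0
  · simp only [fejerKernel, mul_zero, zero_div, Real.sinc_zero]
    nlinarith [sq_nonneg l]
  rw [fejerKernel_of_ne_zero l hu0, le_div_iff₀ (by positivity)]
  have h := Real.cos_le_one_sub_mul_cos_sq (hu.trans (by linarith [Real.pi_gt_three]))
  have hpi : (1 / 8 : ℝ) ≤ 2 / Real.pi ^ 2 := by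
    rw [div_le_div_iff₀ (by norm_num) (by positivity)]
    nlinarith [Real.pi_le_four, Real.pi_pos]
  nlinarith [sq_nonneg (l * u)]

theorem integral_mul_cos_eq_fejerKernel (l u : ℝ) :
    ∫ t in (0 : ℝ)..l, (l - t) * Real.cos (t * u) = fejerKernel l u := by
  rcases eq_or_ne u 0 with rfl | hu
  · have : ∀ t ∈ Set.uIcc 0 l, HasDerivAt (fun t => l * t - t ^ 2 / 2) ((l - t) * Real.cos (t * 0)) t := by
      intro t _
      have := ((hasDerivAt_id t).const_mul l).sub (((hasDerivAt_id t).pow 2).div_const 2)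
      convert! this using 1
      simp
    rw [intervalIntegral.integral_eq_sub_of_hasDerivAt this
      (by apply Continuous.intervalIntegrable; fun_prop)]
    simp [fejerKernel]
    ring
  · have : ∀ t ∈ Set.uIcc 0 l, HasDerivAt
        (fun t => (l - t) * Real.sin (t * u) / u - Real.cos (t * u) / u ^ 2)
        ((l - t) * Real.cos (t * u)) t := by
      intro t _
      have h1 := (hasDerivAt_id t).mul_const u
      have := ((((hasDerivAt_id t).const_sub l).mul h1.sin).div_const u).sub (h1.cos.div_const (u ^ 2))
      convert! this using 1
      simp
      field_simp
      ring
    rw [intervalIntegral.integral_eq_sub_of_hasDerivAt this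
      (by apply Continuous.intervalIntegrable; fun_prop), fejerKernel_of_ne_zero l hu]
    simp
    ring

/-- The weight whose real cosine transform is the Fejér kernel, twisted by `exp (i t y)`. -/
noncomputable def fejerWeight (l y t : ℝ) : ℂ := ((l - t : ℝ) : ℂ) * Complex.exp (t * y * Complex.I)

theorem continuous_fejerWeight (l y : ℝ) : Continuous (fejerWeight l y) := by
  unfold fejerWeight; fun_prop

theorem norm_fejerWeight (l y t : ℝ) : ‖fejerWeight l y t‖ = |l - t| := by
  rw [fejerWeight, norm_mul, ← Complex.ofReal_mul, Complex.norm_exp_ofReal_mul_I, mul_one,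
    Complex.norm_real, Real.norm_eq_abs]

theorem norm_fejerWeight_le {l t : ℝ} (y : ℝ) (hl : 0 ≤ l) (ht : t ∈ Set.uIoc 0 l) :
    ‖fejerWeight l y t‖ ≤ l := by
  rw [Set.uIoc_of_le hl] at ht
  rw [norm_fejerWeight, abs_le]
  constructor <;> linarith [ht.1, ht.2]

theorem re_integral_fejerWeight (l u : ℝ) :
    (∫ t in (0 : ℝ)..l, fejerWeight l u t).re = fejerKernel l u := by
  rw [← integral_mul_cos_eq_fejerKernel]
  have := ContinuousLinearMap.intervalIntegral_comp_comm (μ := MeasureTheory.volume) (a := 0) (b := l)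
    Complex.reCLM ((continuous_fejerWeight l u).intervalIntegrable 0 l)
  simp only [Complex.reCLM_apply] at this
  rw [← this]
  congr 1 with t
  rw [fejerWeight, Complex.re_ofReal_mul, ← Complex.ofReal_mul, Complex.exp_ofReal_mul_I_re]

theorem integral_fejerWeight_mul_exp (l y v : ℝ) :
    (∫ t in (0 : ℝ)..l, fejerWeight l y t * Complex.exp (-(t * v * Complex.I))).re =
      fejerKernel l (y - v) := by
  rw [← re_integral_fejerWeight]
  congr 2 with t
  rw [fejerWeight, fejerWeight, mul_assoc, ← Complex.exp_add]
  congr 2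
  push_cast
  ring

/-- Pairing a Dirichlet series with the Fejér weight gives the Fejér-weighted sum of its
coefficients. -/
theorem hasSum_mul_fejerKernel {a : ℕ → ℝ} {η : ℝ} (hη : 0 < η)
    (ha : LSeriesSummable (fun n => (a n : ℂ)) ((1 + η : ℝ) : ℂ)) {l : ℝ} (hl : 0 ≤ l) (y : ℝ) :
    HasSum (fun n : ℕ => a n / (n : ℝ) ^ (1 + η) * fejerKernel l (y - Real.log n))
      (∫ t in (0 : ℝ)..l, fejerWeight l y t *
        LSeries (fun n => (a n : ℂ)) ((1 + η : ℝ) + t * Complex.I)).re := by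
  set f : ℕ → ℂ := fun n => (a n : ℂ)
  have hnorm (n : ℕ) (t : ℝ) : ‖LSeries.term f ((1 + η : ℝ) + t * Complex.I) n‖ =
      ‖LSeries.term f ((1 + η : ℝ) : ℂ) n‖ := by
    simp [LSeries.norm_term_eq]
  have hcont (n : ℕ) : Continuous fun t : ℝ => LSeries.term f ((1 + η : ℝ) + t * Complex.I) n := by
    rcases eq_or_ne n 0 with rfl | hn
    · simpa using continuous_const
    simp only [LSeries.term_of_ne_zero hn]
    have hn' : (n : ℂ) ≠ 0 := by exact_mod_cast hn
    simp only [Complex.cpow_def_of_ne_zero hn']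
    refine continuous_const.div (by fun_prop) fun t => Complex.exp_ne_zero _
  have key : HasSum (fun n => ∫ t in (0 : ℝ)..l, fejerWeight l y t *
      LSeries.term f ((1 + η : ℝ) + t * Complex.I) n)
      (∫ t in (0 : ℝ)..l, fejerWeight l y t * LSeries f ((1 + η : ℝ) + t * Complex.I)) := by
    refine intervalIntegral.hasSum_integral_of_dominated_convergence
      (fun n _ => l * ‖LSeries.term f ((1 + η : ℝ) : ℂ) n‖) (fun n => ?_) (fun n => ?_) ?_ ?_ ?_
    · exact ((continuous_fejerWeight l y).mul (hcont n)).aestronglyMeasurable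
    · refine Filter.Eventually.of_forall fun t ht => ?_
      rw [norm_mul, hnorm]
      gcongr
      exact norm_fejerWeight_le y hl ht
    · exact Filter.Eventually.of_forall fun t _ => ha.norm.mul_left l
    · exact intervalIntegrable_const
    · refine Filter.Eventually.of_forall fun t _ => HasSum.mul_left _ ?_
      have : LSeriesSummable f ((1 + η : ℝ) + t * Complex.I) := by
        refine Summable.of_norm ?_
        simp only [hnorm]
        exact ha.norm
      exact this.hasSum
  have key2 := (Complex.hasSum_re key)
  convert! key2 using 2 with n
  -- At n = 0 both sides vanish: `LSeries.term` is 0 there by definition, and `a 0 / 0 = 0`.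
  rcases eq_or_ne n 0 with rfl | hn
  · simp [Real.zero_rpow (show 1 + η ≠ 0 by positivity)]
  have hn' : (n : ℂ) ≠ 0 := by exact_mod_cast hn
  have hn0 : (0 : ℝ) < n := by positivity
  rw [← integral_fejerWeight_mul_exp, ← Complex.re_ofReal_mul,
    ← intervalIntegral.integral_const_mul]
  congr 2 with t
  have : LSeries.term f ((1 + η : ℝ) + t * Complex.I) n =
      ((a n / (n : ℝ) ^ (1 + η) : ℝ) : ℂ) * Complex.exp (-(t * Real.log n * Complex.I)) := by
    rw [LSeries.term_of_ne_zero hn, Complex.cpow_add _ _ hn', Complex.exp_neg,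
      Complex.cpow_def_of_ne_zero hn' (t * Complex.I), ← Complex.natCast_log]
    push_cast
    rw [Complex.ofReal_cpow hn0.le]
    push_cast
    rw [show Complex.log (n : ℂ) * (t * Complex.I) = t * Complex.log n * Complex.I by ring]
    field_simp
    rfl
  rw [this]
  ring

/-- The contribution of the pole: 1/(η + it) is the Laplace transform of exp(-(η + it)v), and Fubini
turns the t-integral into a Fejér kernel. -/
theorem re_integral_fejerWeight_div {η : ℝ} (hη : 0 < η) {l : ℝ} (hl : 0 ≤ l) (y : ℝ) :
    (∫ t in (0 : ℝ)..l, fejerWeight l y t / (η + t * Complex.I)).re =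
      ∫ v in Set.Ioi (0 : ℝ), Real.exp (-(η * v)) * fejerKernel l (y - v) := by
  have hlap (t : ℝ) : (η + t * Complex.I : ℂ)⁻¹ =
      ∫ v in Set.Ioi (0 : ℝ), Complex.exp (-(η + t * Complex.I) * v) := by
    rw [integral_exp_mul_complex_Ioi (by simpa using hη)]
    rw [neg_div, Complex.ofReal_zero, mul_zero, Complex.exp_zero, ← div_neg, neg_neg, one_div]
  have : MeasureTheory.IsFiniteMeasure (MeasureTheory.volume.restrict (Set.uIoc 0 l)) := by
    rw [Set.uIoc_of_le hl]; infer_instance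
  have h1 : Continuous fun p : ℝ × ℝ => fejerWeight l y p.1 := 
    (continuous_fejerWeight l y).comp continuous_fst
  have hexp : MeasureTheory.IntegrableOn (fun v : ℝ => Real.exp (-(η * v))) (Set.Ioi 0) := by
    simpa using integrableOn_exp_mul_Ioi (a := -η) (by linarith) 0
  have hint : MeasureTheory.Integrable (Function.uncurry fun t v : ℝ =>
      fejerWeight l y t * Complex.exp (-(η + t * Complex.I) * v))
      ((MeasureTheory.volume.restrict (Set.uIoc 0 l)).prod
        (MeasureTheory.volume.restrict (Set.Ioi 0))) := by
    have hdom : MeasureTheory.Integrable (fun p : ℝ × ℝ => l * Real.exp (-(η * p.2)))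
        ((MeasureTheory.volume.restrict (Set.uIoc 0 l)).prod
        (MeasureTheory.volume.restrict (Set.Ioi 0))) :=
      MeasureTheory.Integrable.mul_prod (f := fun _ : ℝ => l) (MeasureTheory.integrable_const l) hexp
    refine hdom.mono' ?_ ?_
    · refine Continuous.aestronglyMeasurable ?_
      simp only [Function.uncurry_def]
      exact h1.mul (by fun_prop)
    · rw [MeasureTheory.Measure.prod_restrict]
      refine (MeasureTheory.ae_restrict_iff' (measurableSet_uIoc.prod measurableSet_Ioi)).2 ?_
      refine Filter.Eventually.of_forall fun p hp => ?_
      simp only [Function.uncurry_def]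
      rw [norm_mul, Complex.norm_exp]
      have := norm_fejerWeight_le y hl hp.1
      simp only [neg_mul, Complex.neg_re, Complex.re_mul_ofReal, Complex.add_re, Complex.ofReal_re,
        Complex.re_ofReal_mul, Complex.I_re, mul_zero, add_zero]
      gcongr
  simp only [div_eq_mul_inv, hlap, ← MeasureTheory.integral_const_mul]
  rw [MeasureTheory.intervalIntegral_integral_swap hint]
  rw [← Complex.reCLM_apply, ← ContinuousLinearMap.integral_comp_comm]
  · refine MeasureTheory.integral_congr_ae (Filter.Eventually.of_forall fun v => ?_)
    simp only [Complex.reCLM_apply]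
    rw [← integral_fejerWeight_mul_exp, ← Complex.re_ofReal_mul,
      ← intervalIntegral.integral_const_mul]
    congr 2 with t
    rw [show -(η + t * Complex.I : ℂ) * v = ((-(η * v) : ℝ) : ℂ) + -(t * v * Complex.I) by
      push_cast; ring, Complex.exp_add, Complex.ofReal_exp]
    ring
  · have := hint.integral_prod_right
    rw [Set.uIoc_of_le hl] at this
    simpa [intervalIntegral.integral_of_le hl, Function.uncurry_def] using this

theorem fejerKernel_one_le (u : ℝ) : fejerKernel 1 u ≤ 4 * (1 + u ^ 2)⁻¹ := by
  rw [← div_eq_mul_inv, le_div_iff₀ (by positivity)]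
  have h0 := fejerKernel_nonneg 1 u
  have h1 := fejerKernel_le_const 1 u
  rcases eq_or_ne u 0 with rfl | hu
  · linarith
  · have h2 := fejerKernel_le_div_sq 1 hu
    rw [le_div_iff₀ (by positivity)] at h2
    linarith

theorem integrable_fejerKernel_one : MeasureTheory.Integrable (fejerKernel 1) := by
  refine (integrable_inv_one_add_sq.const_mul 4).mono'
    (continuous_fejerKernel 1).aestronglyMeasurable (Filter.Eventually.of_forall fun u => ?_)
  rw [Real.norm_of_nonneg (fejerKernel_nonneg 1 u)]
  exact fejerKernel_one_le u

theorem sq_mul_fejerKernel_one (u : ℝ) : u ^ 2 * fejerKernel 1 u = 1 - Real.cos u := by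
  rcases eq_or_ne u 0 with rfl | hu
  · simp
  · rw [fejerKernel_of_ne_zero 1 hu, one_mul]
    field_simp

/-- Away from the origin every Fejér kernel is dominated by two translates of the first one. -/
theorem exists_fejerKernel_le {δ : ℝ} (hδ : 0 < δ) : ∃ C, 0 ≤ C ∧ ∀ l u : ℝ, δ ≤ |u| →
    fejerKernel l u ≤ C * (fejerKernel 1 u + fejerKernel 1 (u + 1)) := by
  -- The kernel for l = 1 vanishes at nonzero multiples of 2π, hence the second translate: (1 - cos
  -- u) + (1 - cos(u+1)) = 2 - 2 cos(u + 1/2) cos(1/2) ≥ c. The resulting constant depends on δ but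
  -- not on l.
  set c : ℝ := 2 * (1 - Real.cos (1 / 2))
  have hc : 0 < c := by
    have := Real.cos_lt_cos_of_nonneg_of_le_pi (le_refl 0)
      (show 1 / 2 ≤ Real.pi by linarith [Real.pi_gt_three]) (by norm_num)
    rw [Real.cos_zero] at this
    simp only [c]; linarith
  refine ⟨2 / c * (1 + 1 / δ) ^ 2, by positivity, fun l u hu => ?_⟩
  have hu0 : u ≠ 0 := by rintro rfl; simp at hu; linarith
  refine (fejerKernel_le_div_sq l hu0).trans ?_
  have hcos : c ≤ (1 - Real.cos u) + (1 - Real.cos (u + 1)) := by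
    have h1 := Real.cos_add_cos (u + 1) u
    rw [show (u + 1 - u) / 2 = 1 / 2 by ring] at h1
    have h2 := Real.cos_le_one ((u + 1 + u) / 2)
    have h3 : 0 ≤ Real.cos (1 / 2) := (Real.cos_pos_of_mem_Ioo
      ⟨by linarith [Real.pi_gt_three], by linarith [Real.pi_gt_three]⟩).le
    simp only [c]
    nlinarith
  rw [← sq_mul_fejerKernel_one, ← sq_mul_fejerKernel_one] at hcos
  have h1 : u ^ 2 ≤ (1 + 1 / δ) ^ 2 * u ^ 2 := by
    have : (1 : ℝ) ≤ (1 + 1 / δ) ^ 2 := one_le_pow₀ (by have := one_div_pos.2 hδ; linarith)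
    nlinarith [sq_nonneg u]
  have h2 : (u + 1) ^ 2 ≤ (1 + 1 / δ) ^ 2 * u ^ 2 := by
    rw [← mul_pow, sq_le_sq, abs_mul, abs_of_pos (show 0 < 1 + 1 / δ by positivity)]
    have := abs_add_le u 1
    rw [abs_one] at this
    have : 1 ≤ 1 / δ * |u| := by rw [one_div, inv_mul_eq_div, le_div_iff₀ hδ]; linarith
    linarith
  have h3 : c ≤ (1 + 1 / δ) ^ 2 * u ^ 2 * (fejerKernel 1 u + fejerKernel 1 (u + 1)) := by
    nlinarith [mul_le_mul_of_nonneg_right h1 (fejerKernel_nonneg 1 u),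
      mul_le_mul_of_nonneg_right h2 (fejerKernel_nonneg 1 (u + 1))]
  rw [div_le_iff₀ (by positivity)]
  calc (2 : ℝ) = 2 / c * c := by field_simp
    _ ≤ 2 / c * ((1 + 1 / δ) ^ 2 * u ^ 2 * (fejerKernel 1 u + fejerKernel 1 (u + 1))) := by gcongr
    _ = _ := by ring

theorem integrableOn_exp_mul_fejerKernel {η : ℝ} (hη : 0 < η) (l y : ℝ) :
    MeasureTheory.IntegrableOn (fun v => Real.exp (-(η * v)) * fejerKernel l (y - v))
      (Set.Ioi 0) := by
  have hexp : MeasureTheory.IntegrableOn (fun v : ℝ => Real.exp (-(η * v))) (Set.Ioi 0) := by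
    simpa using integrableOn_exp_mul_Ioi (a := -η) (by linarith) 0
  refine (hexp.mul_const (l ^ 2 / 2)).mono' ?_ (Filter.Eventually.of_forall fun v => ?_)
  · have := continuous_fejerKernel l
    exact Continuous.aestronglyMeasurable (by fun_prop)
  · have := fejerKernel_nonneg l (y - v)
    rw [Real.norm_of_nonneg (by positivity)]
    gcongr
    exact fejerKernel_le_const _ _

theorem integral_exp_mul_fejerKernel_one_le {η : ℝ} (hη : 0 < η) (y : ℝ) :
    ∫ v in Set.Ioi (0 : ℝ), Real.exp (-(η * v)) * fejerKernel 1 (y - v) ≤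
      ∫ v, fejerKernel 1 v := by
  have hint : MeasureTheory.Integrable fun v => fejerKernel 1 (y - v) :=
    integrable_fejerKernel_one.comp_sub_left y
  calc _ ≤ ∫ v in Set.Ioi (0 : ℝ), fejerKernel 1 (y - v) := by
        refine MeasureTheory.setIntegral_mono_on (integrableOn_exp_mul_fejerKernel hη 1 y)
          hint.integrableOn measurableSet_Ioi fun v hv => ?_
        have : Real.exp (-(η * v)) ≤ 1 := by
          rw [Real.exp_le_one_iff]
          have := mul_pos hη hv
          linarith
        nlinarith [fejerKernel_nonneg 1 (y - v)]
    _ ≤ ∫ v, fejerKernel 1 (y - v) := MeasureTheory.setIntegral_le_integral hint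
        (Filter.Eventually.of_forall fun v => fejerKernel_nonneg _ _)
    _ = _ := MeasureTheory.integral_sub_left_eq_self (fejerKernel 1) _ y

/-- On the window of length 2/l around y the kernel is at least l^2/8, whence l/4. This is the term
that grows with l. -/
theorem le_integral_exp_mul_fejerKernel {η : ℝ} (hη : 0 < η) {l y : ℝ} (hl : 0 < l)
    (hy : 1 / l < y) :
    l / 4 * Real.exp (-(η * (y + 1 / l))) ≤
      ∫ v in Set.Ioi (0 : ℝ), Real.exp (-(η * v)) * fejerKernel l (y - v) := by
  have hl' : 0 < 1 / l := by positivity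
  have hsub : Set.Icc (y - 1 / l) (y + 1 / l) ⊆ Set.Ioi 0 := fun v hv => by
    have := hv.1
    simp only [Set.mem_Ioi]; linarith
  have hint := integrableOn_exp_mul_fejerKernel hη l y
  calc _ = ∫ _ in Set.Icc (y - 1 / l) (y + 1 / l), l ^ 2 / 8 * Real.exp (-(η * (y + 1 / l))) := by
        rw [MeasureTheory.setIntegral_const, smul_eq_mul, Real.volume_real_Icc_of_le (by linarith)]
        field_simp
        ring
    _ ≤ ∫ v in Set.Icc (y - 1 / l) (y + 1 / l), Real.exp (-(η * v)) * fejerKernel l (y - v) := by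
        refine MeasureTheory.setIntegral_mono_on (MeasureTheory.integrableOn_const (by simp))
          (hint.mono_set hsub) measurableSet_Icc fun v hv => ?_
        rw [mul_comm]
        have h1 : l ^ 2 / 8 ≤ fejerKernel l (y - v) := by
          refine le_fejerKernel ?_
          rw [abs_mul, abs_of_pos hl, ← le_div_iff₀' hl, abs_le]
          constructor <;> linarith [hv.1, hv.2]
        have h2 := hv.2
        gcongr
    _ ≤ _ := MeasureTheory.setIntegral_mono_set hint
        ((MeasureTheory.ae_restrict_iff' measurableSet_Ioi).2 (Filter.Eventually.of_forall
          fun v _ => mul_nonneg (Real.exp_pos _).le (fejerKernel_nonneg _ _)))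
        (Filter.Eventually.of_forall hsub)

/-! ### Boundary limits, the Tauberian theorem and primes in residue classes. -/

theorem ContinuousOn.continuous_comp_one_add {G : ℂ → ℂ} (hG : ContinuousOn G {s | 1 ≤ s.re})
    (η : ℝ) (hη : 0 ≤ η) :
    Continuous fun t : ℝ => G ((1 + η : ℝ) + t * Complex.I) :=
  hG.comp_continuous (by fun_prop) fun t => by simpa using hη

theorem exists_norm_le_of_continuousOn {G : ℂ → ℂ} (hG : ContinuousOn G {s | 1 ≤ s.re})
    (l : ℝ) : ∃ B, 0 ≤ B ∧ ∀ η ∈ Set.Icc (0 : ℝ) 1,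
    ∀ t ∈ Set.Icc 0 l, ‖G ((1 + η : ℝ) + t * Complex.I)‖ ≤ B := by
  have hcont : ContinuousOn (fun p : ℝ × ℝ => G ((1 + p.1 : ℝ) + p.2 * Complex.I))
      (Set.Icc 0 1 ×ˢ Set.Icc 0 l) := by
    refine hG.comp (Continuous.continuousOn (by fun_prop)) fun p hp => ?_
    simpa using hp.1.1
  obtain ⟨B, hB⟩ := (isCompact_Icc.prod isCompact_Icc).exists_bound_of_continuousOn hcont
  exact ⟨max B 0, le_max_right _ _, fun η hη t ht => (hB (η, t) ⟨hη, ht⟩).trans (le_max_left _ _)⟩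

theorem exists_norm_integral_fejerWeight_le {G : ℂ → ℂ} (hG : ContinuousOn G {s | 1 ≤ s.re})
    (l : ℝ) (hl : 0 ≤ l) : ∃ B, ∀ η ∈ Set.Icc (0 : ℝ) 1,
    ∀ y, ‖∫ t in (0 : ℝ)..l, fejerWeight l y t * G ((1 + η : ℝ) + t * Complex.I)‖ ≤ B := by
  obtain ⟨B, hB0, hB⟩ := exists_norm_le_of_continuousOn hG l
  refine ⟨l * B * |l - 0|, fun η hη y => intervalIntegral.norm_integral_le_of_norm_le_const
    fun t ht => ?_⟩
  rw [norm_mul]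
  have h1 := norm_fejerWeight_le y hl ht
  rw [Set.uIoc_of_le hl] at ht
  have := hB η hη t (Set.Ioc_subset_Icc_self ht)
  gcongr

theorem tendsto_integral_fejerWeight_nhdsGT {G : ℂ → ℂ} (hG : ContinuousOn G {s | 1 ≤ s.re})
    (l : ℝ) (hl : 0 ≤ l) (y : ℝ) :
    Tendsto (fun η : ℝ => ∫ t in (0 : ℝ)..l, fejerWeight l y t * G ((1 + η : ℝ) + t * Complex.I))
      (𝓝[>] 0) (𝓝 (∫ t in (0 : ℝ)..l, fejerWeight l y t * G (1 + t * Complex.I))) := by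
  obtain ⟨B, hB0, hB⟩ := exists_norm_le_of_continuousOn hG l
  have hsmall : ∀ᶠ η : ℝ in 𝓝[>] 0, η ∈ Set.Ioc (0 : ℝ) 1 := Ioc_mem_nhdsGT one_pos
  refine intervalIntegral.tendsto_integral_filter_of_dominated_convergence (fun _ => l * B) ?_ ?_
    intervalIntegrable_const ?_
  · filter_upwards [hsmall] with η hη
    exact ((continuous_fejerWeight l y).mul
      (hG.continuous_comp_one_add η hη.1.le)).aestronglyMeasurable
  · filter_upwards [hsmall] with η hη
    refine Filter.Eventually.of_forall fun t ht => ?_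
    rw [norm_mul]
    have h1 := norm_fejerWeight_le y hl ht
    rw [Set.uIoc_of_le hl] at ht
    have := hB η ⟨hη.1.le, hη.2⟩ t (Set.Ioc_subset_Icc_self ht)
    gcongr
  · refine Filter.Eventually.of_forall fun t _ => Tendsto.const_mul _ ?_
    have h := hG (1 + t * Complex.I) (by simp)
    refine h.tendsto.comp (tendsto_nhdsWithin_iff.2 ⟨?_, ?_⟩)
    · have : Continuous fun η : ℝ => ((1 + η : ℝ) : ℂ) + t * Complex.I := by fun_prop
      have h2 := (this.tendsto 0).mono_left (nhdsWithin_le_nhds (s := Set.Ioi (0 : ℝ)))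
      simpa using h2
    · filter_upwards [hsmall] with η hη
      simpa using hη.1.le

/-- The Riemann–Lebesgue lemma. No regularity of G is needed, since the integral of a nonintegrable
function is 0 by convention. -/
theorem tendsto_integral_fejerWeight_atTop (G : ℂ → ℂ) (l : ℝ) (hl : 0 ≤ l) :
    Tendsto (fun y : ℝ => ∫ t in (0 : ℝ)..l, fejerWeight l y t * G (1 + t * Complex.I))
      atTop (𝓝 0) := by
  set f : ℝ → ℂ := (Set.Ioc 0 l).indicator fun t => ((l - t : ℝ) : ℂ) * G (1 + t * Complex.I)
  have h := Real.tendsto_integral_exp_smul_cocompact f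
  have hlin : Tendsto (fun y : ℝ => -(y / (2 * Real.pi))) atTop (cocompact ℝ) := by
    refine Tendsto.mono_right ?_ atBot_le_cocompact
    exact tendsto_neg_atTop_atBot.comp (tendsto_id.atTop_div_const (by positivity))
  refine (h.comp hlin).congr fun y => ?_
  simp only [Function.comp_apply]
  rw [intervalIntegral.integral_of_le hl, ← MeasureTheory.integral_indicator measurableSet_Ioc]
  refine MeasureTheory.integral_congr_ae (Filter.Eventually.of_forall fun t => ?_)
  by_cases ht : t ∈ Set.Ioc 0 l
  · simp only [f, Set.indicator_of_mem ht, fejerWeight, Circle.smul_def, Real.fourierChar_apply,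
      smul_eq_mul]
    rw [show 2 * Real.pi * -(t * -(y / (2 * Real.pi))) = t * y by field_simp]
    push_cast
    ring
  · simp only [f, Set.indicator_of_notMem ht, smul_zero]

/-- A Tauberian theorem for short intervals: if the Dirichlet series of a nonnegative sequence
extends continuously to the closed half plane up to a simple pole at `1`, and the part of the
sequence off `P` has convergent sum `∑ a n / n`, then every short multiplicative interval far out
meets the support of the sequence on `P`. -/
theorem eventually_exists_abs_sub_log_le {a : ℕ → ℝ} (ha : ∀ n, 0 ≤ a n) {A : ℝ} (hA : 0 < A)
    {G : ℂ → ℂ} (hG : ContinuousOn G {s | 1 ≤ s.re})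
    (hsum : ∀ η : ℝ, 0 < η → LSeriesSummable (fun n => (a n : ℂ)) ((1 + η : ℝ) : ℂ))
    (hF : ∀ s : ℂ, 1 < s.re → LSeries (fun n => (a n : ℂ)) s = G s + A / (s - 1))
    {P : ℕ → Prop} [DecidablePred P] (hP : Summable fun n => (if P n then 0 else a n) / (n : ℝ))
    {δ : ℝ} (hδ : 0 < δ) :
    ∀ᶠ y : ℝ in atTop, ∃ n, P n ∧ a n ≠ 0 ∧ |y - Real.log n| ≤ δ := by
  have identity {η : ℝ} (hη : 0 < η) {l : ℝ} (hl : 0 ≤ l) (y : ℝ) :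
      HasSum (fun n : ℕ => a n / (n : ℝ) ^ (1 + η) * fejerKernel l (y - Real.log n))
        ((∫ t in (0 : ℝ)..l, fejerWeight l y t * G ((1 + η : ℝ) + t * Complex.I)).re +
          A * ∫ v in Set.Ioi (0 : ℝ), Real.exp (-(η * v)) * fejerKernel l (y - v)) := by
    convert! hasSum_mul_fejerKernel hη (hsum η hη) hl y using 1
    rw [← re_integral_fejerWeight_div hη hl, ← Complex.re_ofReal_mul, ← Complex.add_re,
      ← intervalIntegral.integral_const_mul, ← intervalIntegral.integral_add]
    · congr 2 with t
      rw [hF _ (by simpa using hη), mul_add]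
      push_cast
      rw [show (1 + η + t * Complex.I - 1 : ℂ) = η + t * Complex.I by ring]
      ring
    · exact ((continuous_fejerWeight l y).mul
        (hG.continuous_comp_one_add η hη.le)).intervalIntegrable _ _
    · refine Continuous.intervalIntegrable (continuous_const.mul
        ((continuous_fejerWeight l y).div (by fun_prop) fun t h => ?_)) _ _
      have := congrArg Complex.re h
      simp at this
      exact hη.ne' this
  -- The case l = 1 yields a Chebyshev-type bound M, uniform in η and y.
  obtain ⟨B, hB⟩ := exists_norm_integral_fejerWeight_le hG 1 zero_le_one
  set M : ℝ := B + A * ∫ v, fejerKernel 1 v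
  have hM {η : ℝ} (hη : η ∈ Set.Ioc (0 : ℝ) 1) (y : ℝ) :
      ∑' n : ℕ, a n / (n : ℝ) ^ (1 + η) * fejerKernel 1 (y - Real.log n) ≤ M := by
    rw [(identity hη.1 zero_le_one y).tsum_eq]
    have h1 := (Complex.re_le_norm _).trans (hB η ⟨hη.1.le, hη.2⟩ y)
    have h2 := mul_le_mul_of_nonneg_left (integral_exp_mul_fejerKernel_one_le hη.1 y) hA.le
    exact add_le_add h1 h2
  obtain ⟨C, hC0, hC⟩ := exists_fejerKernel_le hδ
  -- Since C and M do not depend on l, the main term A * l / 4 can be made to exceed every other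
  -- contribution.
  obtain ⟨l, hl⟩ := exists_gt (max 1 ((C * (M + M) + 2) * 4 / A))
  have hl1 : 1 < l := (le_max_left _ _).trans_lt hl
  have hl0 : 0 < l := by linarith
  have hlA : C * (M + M) + 2 < A * (l / 4) := by
    have := (le_max_right _ _).trans_lt hl
    rw [div_lt_iff₀ hA] at this
    linarith
  have hoff : Tendsto (fun y : ℝ => ∑' n : ℕ, (if P n then 0 else a n) / (n : ℝ) *
      fejerKernel l (y - Real.log n)) atTop (𝓝 0) := by
    have hzero : ∑' n : ℕ, (if P n then 0 else a n) / (n : ℝ) * 0 = 0 := by simp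
    suffices h : Tendsto (fun y : ℝ => ∑' n : ℕ, (if P n then 0 else a n) / (n : ℝ) *
        fejerKernel l (y - Real.log n)) atTop
        (𝓝 (∑' n : ℕ, (if P n then 0 else a n) / (n : ℝ) * 0)) by rwa [hzero] at h
    refine tendsto_tsum_of_dominated_convergence (hP.mul_right (l ^ 2 / 2)) (fun n => ?_) ?_
    · refine Tendsto.const_mul ((if P n then 0 else a n) / (n : ℝ)) ?_
      have htop : Tendsto (fun y : ℝ => 2 / (y - Real.log n) ^ 2) atTop (𝓝 0) :=
        tendsto_const_nhds.div_atTop ((tendsto_pow_atTop two_ne_zero).comp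
          (tendsto_atTop_add_const_right _ _ tendsto_id))
      refine tendsto_of_tendsto_of_tendsto_of_le_of_le' tendsto_const_nhds htop
        (Filter.Eventually.of_forall fun y => fejerKernel_nonneg _ _) ?_
      filter_upwards [eventually_gt_atTop (Real.log n)] with y hy
      exact fejerKernel_le_div_sq l (by linarith)
    · refine Filter.Eventually.of_forall fun y n => ?_
      have h1 : 0 ≤ (if P n then 0 else a n) / (n : ℝ) := by
        have := ha n; split_ifs <;> positivity
      rw [Real.norm_of_nonneg (mul_nonneg h1 (fejerKernel_nonneg _ _))]
      gcongr
      exact fejerKernel_le_const _ _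
  have hRL := (Complex.continuous_re.tendsto 0).comp (tendsto_integral_fejerWeight_atTop G l hl0.le)
  filter_upwards [hoff.eventually_lt_const zero_lt_one,
    hRL.eventually_const_lt (show (-1 : ℝ) < (0 : ℂ).re by simp),
    eventually_gt_atTop (1 / l)] with y hy1 hy2 hy3
  by_contra! hno
  -- If the window is empty, terms on P are dominated by the l = 1 kernels at y and y + 1, costing C
  -- * (M + M); terms off P cost at most 1.
  have hineq : ∀ η ∈ Set.Ioc (0 : ℝ) 1,
      (∫ t in (0 : ℝ)..l, fejerWeight l y t * G ((1 + η : ℝ) + t * Complex.I)).re +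
        A * (l / 4 * Real.exp (-(η * (y + 1 / l)))) ≤ 1 + C * (M + M) := by
    intro η hη
    have hs := identity hη.1 hl0.le y
    have hs1 := identity hη.1 zero_le_one y
    have hs2 := identity hη.1 zero_le_one (y + 1)
    have hpt : ∀ n : ℕ, a n / (n : ℝ) ^ (1 + η) * fejerKernel l (y - Real.log n) ≤
        (if P n then 0 else a n) / (n : ℝ) * fejerKernel l (y - Real.log n) +
        C * (a n / (n : ℝ) ^ (1 + η) * fejerKernel 1 (y - Real.log n) +
          a n / (n : ℝ) ^ (1 + η) * fejerKernel 1 (y + 1 - Real.log n)) := by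
      intro n
      have hk := fejerKernel_nonneg l (y - Real.log n)
      have hk1 := fejerKernel_nonneg 1 (y - Real.log n)
      have hk2 := fejerKernel_nonneg 1 (y + 1 - Real.log n)
      have han := ha n
      have hq : 0 ≤ a n / (n : ℝ) ^ (1 + η) := by positivity
      by_cases hPn : P n
      · simp only [hPn, if_true, zero_div, zero_mul, zero_add]
        by_cases h0 : a n = 0
        · simp [h0]
        · have h := hC l (y - Real.log n) (hno n hPn h0).le
          rw [show y - Real.log n + 1 = y + 1 - Real.log n by ring] at h
          calc _ ≤ a n / (n : ℝ) ^ (1 + η) * (C * (fejerKernel 1 (y - Real.log n) +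
                fejerKernel 1 (y + 1 - Real.log n))) := by gcongr
            _ = _ := by ring
      · simp only [hPn, if_false]
        have : a n / (n : ℝ) ^ (1 + η) ≤ a n / n := by
          rcases Nat.eq_zero_or_pos n with rfl | hn
          · simp [Real.zero_rpow (show 1 + η ≠ 0 by linarith [hη.1])]
          · have hn1 : (1 : ℝ) ≤ n := by exact_mod_cast hn
            have : (n : ℝ) ≤ (n : ℝ) ^ (1 + η) := by
              conv_lhs => rw [← Real.rpow_one (n : ℝ)]
              exact Real.rpow_le_rpow_of_exponent_le hn1 (by linarith [hη.1])
            gcongr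
        have h1 : a n / (n : ℝ) ^ (1 + η) * fejerKernel l (y - Real.log n) ≤
          a n / n * fejerKernel l (y - Real.log n) := by gcongr
        have : 0 ≤ C * (a n / (n : ℝ) ^ (1 + η) * fejerKernel 1 (y - Real.log n) +
          a n / (n : ℝ) ^ (1 + η) * fejerKernel 1 (y + 1 - Real.log n)) := by positivity
        linarith
    have hoffs : Summable fun n : ℕ => (if P n then 0 else a n) / (n : ℝ) *
        fejerKernel l (y - Real.log n) := by
      refine (hP.mul_right (l ^ 2 / 2)).of_nonneg_of_le (fun n => ?_) (fun n => ?_)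
      all_goals
        have h1 : 0 ≤ (if P n then 0 else a n) / (n : ℝ) := by
          have := ha n; split_ifs <;> positivity
      · exact mul_nonneg h1 (fejerKernel_nonneg _ _)
      · gcongr
        exact fejerKernel_le_const _ _
    have hle := hasSum_le hpt hs (hoffs.hasSum.add ((hs1.add hs2).mul_left C))
    rw [← hs1.tsum_eq, ← hs2.tsum_eq] at hle
    have hM1 := hM hη y
    have hM2 := hM hη (y + 1)
    have hlow := mul_le_mul_of_nonneg_left
      (le_integral_exp_mul_fejerKernel hη.1 hl0 hy3) hA.le
    have := mul_le_mul_of_nonneg_left (add_le_add hM1 hM2) hC0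
    linarith
  -- η tends to 0 with y fixed, because the Riemann–Lebesgue bound `hy2` concerns the line Re s = 1.
  have hlim : Tendsto (fun η : ℝ =>
      (∫ t in (0 : ℝ)..l, fejerWeight l y t * G ((1 + η : ℝ) + t * Complex.I)).re +
        A * (l / 4 * Real.exp (-(η * (y + 1 / l))))) (𝓝[>] 0)
      (𝓝 ((∫ t in (0 : ℝ)..l, fejerWeight l y t * G (1 + t * Complex.I)).re + A * (l / 4 * 1))) := by
    refine ((Complex.continuous_re.tendsto _).comp
      (tendsto_integral_fejerWeight_nhdsGT hG l hl0.le y)).add ?_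
    have hc : Continuous fun η : ℝ => A * (l / 4 * Real.exp (-(η * (y + 1 / l)))) := by fun_prop
    simpa using (hc.tendsto 0).mono_left (nhdsWithin_le_nhds (s := Set.Ioi (0 : ℝ)))
  have hfin := le_of_tendsto hlim (by
    filter_upwards [Ioc_mem_nhdsGT one_pos] with η hη using hineq η hη)
  simp only [Function.comp_apply] at hy2
  linarith

/-- Primes in a residue class coprime to the modulus, in short multiplicative intervals. -/
theorem eventually_exists_prime_eq_mod {q : ℕ} [NeZero q] {a : ZMod q} (ha : IsUnit a) {δ : ℝ}
    (hδ : 0 < δ) :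
    ∀ᶠ y : ℝ in atTop, ∃ p : ℕ, p.Prime ∧ (p : ZMod q) = a ∧ |y - Real.log p| ≤ δ := by
  classical
  -- The sequence is the von Mangoldt function on the class, with residue 1/φ(q). The proper prime
  -- powers have a convergent sum and play the part off P.
  have h := eventually_exists_abs_sub_log_le
    (ArithmeticFunction.vonMangoldt.residueClass_nonneg a)
    (A := (q.totient : ℝ)⁻¹) (by have := Nat.totient_pos.2 (NeZero.pos q); positivity)
    (ArithmeticFunction.vonMangoldt.continuousOn_LFunctionResidueClassAux a)
    (fun η hη => LSeriesSummable_of_abscissaOfAbsConv_lt_re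
      ((ArithmeticFunction.vonMangoldt.abscissaOfAbsConv_residueClass_le_one a).trans_lt (by
        rw [Complex.ofReal_re]; exact_mod_cast (by linarith : (1 : ℝ) < 1 + η))))
    (fun s hs => by
      rw [ArithmeticFunction.vonMangoldt.eqOn_LFunctionResidueClassAux ha hs]
      push_cast
      ring)
    (P := Nat.Prime) (ArithmeticFunction.vonMangoldt.summable_residueClass_non_primes_div a) hδ
  filter_upwards [h] with y hy
  obtain ⟨p, hp, hne, hle⟩ := hy
  exact ⟨p, hp, (Set.indicator_apply_ne_zero.1 hne).1, hle⟩

/-! ### Shadows, expansions and triangle counting. -/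

open scoped FinsetFamily in
/-- Every family contains a subfamily in which all shadow members have degree at least `d`, at the
cost of at most `d` sets per shadow member. -/
theorem exists_subset_full {V : Type*} [DecidableEq V] (H : Finset (Finset V)) (d : ℕ) :
    ∃ H' ⊆ H, H.card ≤ H'.card + d * (∂ H).card ∧
      ∀ e ∈ ∂ H', d ≤ (H'.filter (e ⊆ ·)).card := by
  -- For a maximiser of |K| - d|∂K|, a shadow member of degree below d is impossible: removing the
  -- sets containing it loses fewer than d sets and at least one shadow member.
  obtain ⟨H', hH', hmax⟩ := H.powerset.exists_max_image
    (fun K => (K.card : ℤ) - d * (∂ K).card) ⟨H, Finset.mem_powerset_self H⟩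
  refine ⟨H', Finset.mem_powerset.1 hH', ?_, fun e he => ?_⟩
  · have h := hmax H (Finset.mem_powerset_self H)
    have h0 : (0 : ℤ) ≤ d * (∂ H').card := by positivity
    zify
    linarith
  · by_contra! hlt
    set K := H'.filter (¬ e ⊆ ·)
    have hK : K ⊆ H' := Finset.filter_subset _ _
    have h := hmax K (Finset.mem_powerset.2 (hK.trans (Finset.mem_powerset.1 hH')))
    have hsh : ∂ K ⊆ (∂ H').erase e := by
      intro f hf
      rw [Finset.mem_erase]
      refine ⟨?_, Finset.shadow_mono hK hf⟩
      rintro rfl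
      obtain ⟨s, hs, hsub⟩ := Finset.exists_subset_of_mem_shadow hf
      exact (Finset.mem_filter.1 hs).2 hsub
    have hc := Finset.card_le_card hsh
    rw [Finset.card_erase_of_mem he] at hc
    have hpos : 0 < (∂ H').card := Finset.card_pos.2 ⟨e, he⟩
    have hsplit := Finset.card_filter_add_card_filter_not (s := H') (e ⊆ ·)
    have hc' : ((∂ K).card : ℤ) ≤ (∂ H').card - 1 := by omega
    have h1 : (d : ℤ) * (∂ K).card ≤ d * ((∂ H').card - 1) := by gcongr
    have hs' : ((H'.filter (e ⊆ ·)).card : ℤ) + K.card = H'.card := by exact_mod_cast hsplit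
    have : ((H'.filter (e ⊆ ·)).card : ℤ) < d := by exact_mod_cast hlt
    linarith

open scoped FinsetFamily in
/-- If all pairs in the shadow of a `3`-graph have large degree, then a copy of `G` in the shadow
extends to a copy of the expansion of `G`. -/
theorem containsCopy_graphExpansion {W V : Type*} [Fintype W] [DecidableEq V] [Fintype V]
    (G : SimpleGraph W) {H : Finset (Finset V)} (hH : (H : Set (Finset V)).Sized 3)
    (hd : ∀ e ∈ ∂ H, Fintype.card W + Nat.card G.edgeSet ≤ (H.filter (e ⊆ ·)).card)
    (g : W ↪ V) (hg : ∀ u v, G.Adj u v → {g u, g v} ∈ ∂ H) :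
    ContainsCopy (graphExpansion G) H := by
  classical
  have hfin : Finite G.edgeSet := inferInstance
  have := Fintype.ofFinite G.edgeSet
  let E : G.edgeSet → Finset V := fun e => (e : Sym2 W).toFinset.map g
  have hE : ∀ e, E e ∈ ∂ H := by
    rintro ⟨e, he⟩
    induction e using Sym2.ind with
    | _ u v =>
      simp only [E, Sym2.toFinset_mk_eq, Finset.map_insert, Finset.map_singleton]
      exact hg u v he
  let T : G.edgeSet → Finset V := fun e =>
    Finset.univ.filter fun v => v ∉ Finset.univ.map g ∧ insert v (E e) ∈ H
  have hT : ∀ e, Fintype.card G.edgeSet ≤ (T e).card := by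
    intro e
    have h1 : H.filter (E e ⊆ ·) ⊆ (T e ∪ Finset.univ.map g).image fun v => insert v (E e) := by
      intro s hs
      obtain ⟨hsH, hes⟩ := Finset.mem_filter.1 hs
      have hcard : (E e).card + 1 = s.card := by
        rw [hH hsH, (hH.shadow) (hE e)]
      obtain ⟨a, ha, rfl⟩ := Finset.exists_eq_insert_iff.2 ⟨hes, hcard⟩
      refine Finset.mem_image.2 ⟨a, ?_, rfl⟩
      by_cases hr : a ∈ Finset.univ.map g
      · exact Finset.mem_union_right _ hr
      · exact Finset.mem_union_left _ (Finset.mem_filter.2 ⟨Finset.mem_univ _, hr, hsH⟩)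
    have h2 := (Finset.card_le_card h1).trans (Finset.card_image_le.trans (Finset.card_union_le _ _))
    have h3 := hd _ (hE e)
    rw [Finset.card_map, Finset.card_univ] at h2
    rw [Nat.card_eq_fintype_card] at h3
    omega
  -- Hall's condition is immediate, as each candidate set alone has at least as many elements as G
  -- has edges.
  obtain ⟨f, hf, hfT⟩ := (Finset.all_card_le_biUnion_card_iff_exists_injective T).1 fun s => by
    rcases s.eq_empty_or_nonempty with rfl | ⟨e, he⟩
    · simp
    · exact (Finset.card_le_univ s).trans ((hT e).trans
        (Finset.card_le_card (Finset.subset_biUnion_of_mem T he)))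
  have hfT' (e : G.edgeSet) : (∀ w, g w ≠ f e) ∧ insert (f e) (E e) ∈ H := by
    have := (Finset.mem_filter.1 (hfT e)).2
    simpa using this
  refine ⟨⟨Sum.elim g f, ?_⟩, ?_⟩
  · rw [Sum.elim_injective]
    exact ⟨g.injective, hf, fun w e => (hfT' e).1 w⟩
  · intro s hs
    unfold graphExpansion at hs
    obtain ⟨e, -, rfl⟩ := Finset.mem_image.1 hs
    convert! (hfT' e).2 using 1
    ext v
    simp only [Finset.mem_map, Finset.mem_disjSum, Finset.mem_insert, Function.Embedding.coeFn_mk, E]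
    constructor
    · rintro ⟨x, ⟨a, ha, rfl⟩ | ⟨b, hb, rfl⟩, rfl⟩
      · right; exact ⟨a, by simpa using ha, rfl⟩
      · left; rw [Finset.mem_singleton.1 hb]; rfl
    · rintro (rfl | ⟨a, ha, rfl⟩)
      · exact ⟨Sum.inr e, Or.inr ⟨e, by simp, rfl⟩, rfl⟩
      · exact ⟨Sum.inl a, Or.inl ⟨a, by simpa using ha, rfl⟩, rfl⟩

/-- The number of ordered triangles in a graph in which any three vertices have few common
neighbours is quadratic. -/
theorem sum_triangle_le {V : Type*} [Fintype V] [DecidableEq V] {A : V → V → ℝ} {t : ℝ}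
    (ht : 0 ≤ t) (h01 : ∀ u v, A u v = 0 ∨ A u v = 1) (hirr : ∀ u, A u u = 0)
    (hsymm : ∀ u v, A u v = A v u)
    (hcod : ∀ a b c, a ≠ b → a ≠ c → b ≠ c → ∑ v, A v a * A v b * A v c ≤ t) :
    ∑ v, ∑ u, ∑ w, A v u * A v w * A u w ≤ (t + 3) * (Fintype.card V : ℝ) ^ 2 := by
  set n : ℝ := (Fintype.card V : ℝ)
  have hn : 0 ≤ n := Nat.cast_nonneg _
  have h0 : ∀ u v, 0 ≤ A u v := fun u v => by rcases h01 u v with h | h <;> simp [h]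
  have h1 : ∀ u v, A u v ≤ 1 := fun u v => by rcases h01 u v with h | h <;> simp [h]
  have hsq : ∀ u v, A u v ^ 2 = A u v := fun u v => by rcases h01 u v with h | h <;> simp [h]
  let d : V → ℝ := fun v => ∑ u, A v u
  have hd0 : ∀ v, 0 ≤ d v := fun v => Finset.sum_nonneg fun u _ => h0 v u
  let E : V → ℝ := fun v => ∑ u, ∑ w, A v u * A v w * A u w
  -- `E v` counts ordered adjacent pairs inside the neighbourhood of v. After Cauchy–Schwarz over
  -- neighbours u, expanding the square counts common neighbours u of v, w, w', at most t unless w =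
  -- w'.
  have hE : ∀ v, E v ^ 2 ≤ (t + 1) * d v ^ 3 := by
    intro v
    have hE1 : E v = ∑ u, A v u * (A v u * ∑ w, A v w * A u w) := by
      refine Finset.sum_congr rfl fun u _ => ?_
      rw [← mul_assoc, ← sq, hsq, Finset.mul_sum]
      exact Finset.sum_congr rfl fun w _ => by ring
    have hcs := Finset.sum_mul_sq_le_sq_mul_sq Finset.univ (fun u => A v u)
      (fun u => A v u * ∑ w, A v w * A u w)
    rw [← hE1] at hcs
    refine hcs.trans ?_
    simp only [hsq, mul_pow]
    have hexp : ∑ u, A v u * (∑ w, A v w * A u w) ^ 2 =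
        ∑ w, ∑ w', A v w * A v w' * ∑ u, A v u * A u w * A u w' := by
      have : ∀ u, A v u * (∑ w, A v w * A u w) ^ 2 =
          ∑ w, ∑ w', A v w * A v w' * (A v u * A u w * A u w') := fun u => by
        rw [sq, Finset.sum_mul_sum, Finset.mul_sum]
        refine Finset.sum_congr rfl fun w _ => ?_
        rw [Finset.mul_sum]
        exact Finset.sum_congr rfl fun w' _ => by ring
      simp only [this]
      rw [Finset.sum_comm]
      refine Finset.sum_congr rfl fun w _ => ?_
      rw [Finset.sum_comm]
      exact Finset.sum_congr rfl fun w' _ => by rw [Finset.mul_sum]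
    have hin : ∀ w w', A v w * A v w' * ∑ u, A v u * A u w * A u w' ≤
        A v w * A v w' * t + if w = w' then A v w * d v else 0 := by
      intro w w'
      split_ifs with hww
      · subst hww
        rw [← sq, hsq]
        have : ∑ u, A v u * A u w * A u w ≤ d v := Finset.sum_le_sum fun u _ => by
          rw [mul_assoc, ← sq, hsq]
          nlinarith [h0 v u, h1 u w]
        have := mul_le_mul_of_nonneg_left this (h0 v w)
        nlinarith [mul_nonneg (h0 v w) ht]
      · rw [add_zero]
        rcases h01 v w with h | h
        · simp [h]
        rcases h01 v w' with h' | h'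
        · simp [h']
        rw [h, h', one_mul, one_mul, one_mul]
        have hne : v ≠ w := by rintro rfl; rw [hirr] at h; norm_num at h
        have hne' : v ≠ w' := by rintro rfl; rw [hirr] at h'; norm_num at h'
        simpa only [hsymm v] using hcod v w w' hne hne' hww
    have hsum : ∑ u, A v u * (∑ w, A v w * A u w) ^ 2 ≤ (t + 1) * d v ^ 2 := by
      rw [hexp]
      refine (Finset.sum_le_sum fun w _ => Finset.sum_le_sum fun w' _ => hin w w').trans ?_
      simp only [Finset.sum_add_distrib, Finset.sum_ite_eq, Finset.mem_univ, if_true]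
      simp only [← Finset.sum_mul, ← Finset.mul_sum, d]
      apply le_of_eq
      ring
    calc (∑ u, A v u) * ∑ u, A v u * (∑ w, A v w * A u w) ^ 2
        ≤ d v * ((t + 1) * d v ^ 2) := mul_le_mul_of_nonneg_left hsum (hd0 v)
      _ = _ := by ring
  -- The sum counts triples (a, b, c) with a common neighbour v: distinct triples have at most t,
  -- and the at most 3n^2 degenerate ones have at most n each.
  have hd3 : ∑ v, d v ^ 3 ≤ (t + 3) * n ^ 3 := by
    have hexp : ∑ v, d v ^ 3 = ∑ a, ∑ b, ∑ c, ∑ v, A v a * A v b * A v c := by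
      have : ∀ v, d v ^ 3 = ∑ a, ∑ b, ∑ c, A v a * A v b * A v c := fun v => by
        rw [pow_three, Finset.sum_mul_sum, Finset.sum_mul_sum]
        refine Finset.sum_congr rfl fun a _ => Finset.sum_congr rfl fun b _ => ?_
        rw [Finset.mul_sum]
        exact Finset.sum_congr rfl fun c _ => by ring
      simp only [this]
      rw [Finset.sum_comm]
      refine Finset.sum_congr rfl fun a _ => ?_
      rw [Finset.sum_comm]
      refine Finset.sum_congr rfl fun b _ => ?_
      rw [Finset.sum_comm]
    rw [hexp]
    have hin : ∀ a b c, ∑ v, A v a * A v b * A v c ≤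
        t + ((if a = b then n else 0) + (if a = c then n else 0) + (if b = c then n else 0)) := by
      intro a b c
      have htriv : ∑ v, A v a * A v b * A v c ≤ n := by
        refine (Finset.sum_le_sum (g := fun _ => (1 : ℝ)) fun v _ => ?_).trans (by simp [n])
        exact mul_le_one₀ (mul_le_one₀ (h1 _ _) (h0 _ _) (h1 _ _)) (h0 _ _) (h1 _ _)
      by_cases hab : a = b
      · rw [if_pos hab]
        split_ifs <;> linarith
      by_cases hac : a = c
      · rw [if_pos hac]
        split_ifs <;> linarith
      by_cases hbc : b = c
      · rw [if_pos hbc, if_neg hab, if_neg hac]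
        linarith
      simpa [hab, hac, hbc] using hcod a b c hab hac hbc
    refine (Finset.sum_le_sum fun a _ => Finset.sum_le_sum fun b _ =>
      Finset.sum_le_sum fun c _ => hin a b c).trans (le_of_eq ?_)
    simp only [Finset.sum_add_distrib, Finset.sum_ite_eq, Finset.mem_univ, if_true,
      Finset.sum_const, Finset.card_univ, nsmul_eq_mul, ← Finset.mul_sum]
    simp only [n]
    ring
  have hfin : (∑ v, E v) ^ 2 ≤ ((t + 3) * n ^ 2) ^ 2 := by
    have hcs := Finset.sum_mul_sq_le_sq_mul_sq Finset.univ (fun _ : V => (1 : ℝ)) E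
    simp only [one_mul, one_pow, Finset.sum_const, Finset.card_univ, nsmul_eq_mul, mul_one] at hcs
    calc _ ≤ n * ∑ v, E v ^ 2 := hcs
      _ ≤ n * ((t + 1) * ((t + 3) * n ^ 3)) := by
          refine mul_le_mul_of_nonneg_left ?_ hn
          refine (Finset.sum_le_sum fun v _ => hE v).trans ?_
          rw [← Finset.mul_sum]
          exact mul_le_mul_of_nonneg_left hd3 (by linarith)
      _ ≤ _ := by nlinarith [show 0 ≤ (t + 3) * n ^ 4 by positivity]
  exact abs_le_of_sq_le_sq' hfin (by positivity) |>.2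

/-! ### The quadratic upper bound. -/

theorem le_turanNumber {W : Type*} {k n : ℕ} {F : Finset (Finset W)} {H : Finset (Finset (Fin n))}
    (hH : (H : Set (Finset (Fin n))).Sized k) (hF : ¬ ContainsCopy F H) :
    H.card ≤ turanNumber k n F := by
  unfold turanNumber
  exact Finset.le_sup (f := Finset.card) (by simpa using ⟨hH, hF⟩)

theorem turanNumber_le {W : Type*} {k n : ℕ} {F : Finset (Finset W)} {m : ℕ}
    (h : ∀ H : Finset (Finset (Fin n)), (H : Set (Finset (Fin n))).Sized k → ¬ ContainsCopy F H →
      H.card ≤ m) : turanNumber k n F ≤ m := by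
  unfold turanNumber
  refine Finset.sup_le fun H hH => ?_
  have : (H : Set (Finset (Fin n))).Sized k ∧ ¬ ContainsCopy F H := by simpa using hH
  exact h H this.1 this.2

theorem exists_embedding_completeBipartite {V : Type*} {R : V → V → Prop}
    (hirr : ∀ v, ¬ R v v) (hsymm : ∀ u v, R u v → R v u) {t : ℕ} {a b c : V} (hab : a ≠ b)
    (hac : a ≠ c) (hbc : b ≠ c) {N : Finset V} (hN : ∀ v ∈ N, R v a ∧ R v b ∧ R v c)
    (ht : t ≤ N.card) :
    ∃ g : Fin 3 ⊕ Fin t ↪ V, ∀ u v, (completeBipartiteGraph (Fin 3) (Fin t)).Adj u v →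
      R (g u) (g v) := by
  obtain ⟨N', hN', hcard⟩ := Finset.exists_subset_card_eq ht
  let e : Fin t ↪ V := ⟨fun i => (N'.equivFinOfCardEq hcard).symm i,
    Subtype.val_injective.comp (Equiv.injective _)⟩
  have he : ∀ i, e i ∈ N := fun i => hN' ((N'.equivFinOfCardEq hcard).symm i).2
  have hR : ∀ i j, R (e j) (![a, b, c] i) := by
    intro i j
    have h := hN _ (he j)
    fin_cases i
    exacts [h.1, h.2.1, h.2.2]
  refine ⟨⟨Sum.elim ![a, b, c] e, Sum.elim_injective.2 ⟨?_, e.injective, ?_⟩⟩, ?_⟩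
  · intro i j hij
    fin_cases i <;> fin_cases j <;> simp_all
  · intro i j h
    exact hirr (e j) (by simpa only [h] using hR i j)
  · rintro (u | u) (v | v) h
    · simp at h
    · exact hsymm _ _ (hR u v)
    · exact hR v u
    · simp at h

open scoped FinsetFamily in
theorem card_shadow_le_sq {V : Type*} [Fintype V] [DecidableEq V] {H : Finset (Finset V)}
    (hH : (H : Set (Finset V)).Sized 3) : (∂ H).card ≤ Fintype.card V ^ 2 := by
  have h : ∂ H ⊆ (Finset.univ : Finset V).powersetCard 2 := fun e he =>
    Finset.mem_powersetCard.2 ⟨Finset.subset_univ _, hH.shadow he⟩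
  refine (Finset.card_le_card h).trans ?_
  rw [Finset.card_powersetCard, Finset.card_univ]
  exact Nat.choose_le_pow _ _

open scoped FinsetFamily in
theorem card_le_of_not_containsCopy {V : Type*} [Fintype V] [DecidableEq V] {t : ℕ}
    {H : Finset (Finset V)} (hH : (H : Set (Finset V)).Sized 3)
    (hF : ¬ ContainsCopy (graphExpansion (completeBipartiteGraph (Fin 3) (Fin t))) H) :
    (H.card : ℝ) ≤ ((Fintype.card (Fin 3 ⊕ Fin t) +
      Nat.card (completeBipartiteGraph (Fin 3) (Fin t)).edgeSet : ℕ) + (t + 3)) *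
        (Fintype.card V : ℝ) ^ 2 := by
  set d := Fintype.card (Fin 3 ⊕ Fin t) + Nat.card (completeBipartiteGraph (Fin 3) (Fin t)).edgeSet
  obtain ⟨K, hKH, hcard, hfull⟩ := exists_subset_full H d
  have hK : (K : Set (Finset V)).Sized 3 := fun s hs => hH (hKH hs)
  let R : V → V → Prop := fun u v => u ≠ v ∧ {u, v} ∈ ∂ K
  have hirr : ∀ v, ¬ R v v := fun v h => h.1 rfl
  have hsymm : ∀ u v, R u v → R v u := fun u v h => ⟨h.1.symm, by rw [Finset.pair_comm]; exact h.2⟩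
  let A : V → V → ℝ := fun u v => if R u v then 1 else 0
  have htri : ∑ v, ∑ u, ∑ w, A v u * A v w * A u w ≤ ((t : ℝ) + 3) * (Fintype.card V : ℝ) ^ 2 := by
    refine sum_triangle_le (Nat.cast_nonneg t) (fun u v => ?_) (fun u => ?_) (fun u v => ?_)
      fun a b c hab hac hbc => ?_
    · by_cases h : R u v <;> simp [A, h]
    · simp [A, hirr]
    · simp only [A, show R u v ↔ R v u from ⟨hsymm u v, hsymm v u⟩]
    · by_contra! hlt
      have hN : ∑ v, A v a * A v b * A v c =
          ((Finset.univ.filter fun v => R v a ∧ R v b ∧ R v c).card : ℝ) := by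
        rw [Finset.card_filter]
        push_cast
        refine Finset.sum_congr rfl fun v _ => ?_
        by_cases h1 : R v a <;> by_cases h2 : R v b <;> by_cases h3 : R v c <;>
          simp [A, h1, h2, h3]
      rw [hN] at hlt
      obtain ⟨g, hg⟩ := exists_embedding_completeBipartite hirr hsymm hab hac hbc
        (fun v hv => (Finset.mem_filter.1 hv).2) (by exact_mod_cast hlt.le)
      obtain ⟨f, hf⟩ := containsCopy_graphExpansion _ hK hfull g fun u v h => (hg u v h).2
      exact hF ⟨f, fun e he => hKH (hf e he)⟩
  have hKtri : (K.card : ℝ) ≤ ∑ v, ∑ u, ∑ w, A v u * A v w * A u w := by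
    let T : Finset (V × V × V) := Finset.univ.filter fun p => R p.1 p.2.1 ∧ R p.1 p.2.2 ∧ R p.2.1 p.2.2
    have hT : ∑ v, ∑ u, ∑ w, A v u * A v w * A u w = (T.card : ℝ) := by
      rw [Finset.card_filter, Fintype.sum_prod_type]
      push_cast
      refine Finset.sum_congr rfl fun v _ => ?_
      rw [Fintype.sum_prod_type]
      refine Finset.sum_congr rfl fun u _ => Finset.sum_congr rfl fun w _ => ?_
      by_cases h1 : R v u <;> by_cases h2 : R v w <;> by_cases h3 : R u w <;>
          simp [A, h1, h2, h3]
    rw [hT]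
    -- All three pairs of an edge lie in the shadow, so each edge comes from an ordered triangle.
    have hsub : K ⊆ T.image fun p => {p.1, p.2.1, p.2.2} := by
      intro s hs
      obtain ⟨x, y, z, hxy, hxz, hyz, rfl⟩ := Finset.card_eq_three.1 (hK hs)
      refine Finset.mem_image.2 ⟨(x, y, z), Finset.mem_filter.2 ⟨Finset.mem_univ _, ?_⟩, rfl⟩
      have hmem : ∀ u ∈ ({x, y, z} : Finset V), ({x, y, z} : Finset V).erase u ∈ ∂ K := fun u hu =>
        Finset.erase_mem_shadow hs hu
      refine ⟨⟨hxy, ?_⟩, ⟨hxz, ?_⟩, ⟨hyz, ?_⟩⟩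
      · convert! hmem z (by simp) using 1
        ext v; simp only [Finset.mem_insert, Finset.mem_singleton, Finset.mem_erase]; grind
      · convert! hmem y (by simp) using 1
        ext v; simp only [Finset.mem_insert, Finset.mem_singleton, Finset.mem_erase]; grind
      · convert! hmem x (by simp) using 1
        ext v; simp only [Finset.mem_insert, Finset.mem_singleton, Finset.mem_erase]; grind
    exact_mod_cast (Finset.card_le_card hsub).trans Finset.card_image_le
  have hsh : ((∂ H).card : ℝ) ≤ (Fintype.card V : ℝ) ^ 2 := by exact_mod_cast card_shadow_le_sq hH
  have hcard' : (H.card : ℝ) ≤ K.card + d * (∂ H).card := by exact_mod_cast hcard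
  have := mul_le_mul_of_nonneg_left hsh (Nat.cast_nonneg (α := ℝ) d)
  linarith

theorem turanNumber_graphExpansion_isBigO (t : ℕ) :
    (fun n : ℕ =>
      (turanNumber 3 n (graphExpansion (completeBipartiteGraph (Fin 3) (Fin t))) : ℝ))
      =O[atTop] (fun n : ℕ => (n : ℝ) ^ 2) := by
  set C : ℕ := Fintype.card (Fin 3 ⊕ Fin t) +
      Nat.card (completeBipartiteGraph (Fin 3) (Fin t)).edgeSet + (t + 3) with hC
  refine IsBigO.of_bound C (Filter.Eventually.of_forall fun n => ?_)
  rw [Real.norm_of_nonneg (by positivity), Real.norm_of_nonneg (by positivity)]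
  have : turanNumber 3 n (graphExpansion (completeBipartiteGraph (Fin 3) (Fin t))) ≤ C * n ^ 2 :=
    turanNumber_le fun H hH hF => by
      have := card_le_of_not_containsCopy hH hF
      rw [Fintype.card_fin n] at this
      rw [hC]
      exact_mod_cast this
  exact_mod_cast this

/-! ### Common neighbours in the norm graph. -/

/-- Vertices of the norm graph on a field `K`: pairs of an element and a `d`-th power of a unit. -/
abbrev NormVertex (K : Type*) [Field K] (d : ℕ) : Type _ :=
  K × (powMonoidHom d : Kˣ →* Kˣ).range

/-- Adjacency of the norm graph: `(A, a)` and `(B, b)` are joined if `(A + B) ^ d = a * b`. -/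
def NormVertex.Adj {K : Type*} [Field K] {d : ℕ} (u v : NormVertex K d) : Prop :=
  u ≠ v ∧ ∃ x : Kˣ, (x : K) = u.1 + v.1 ∧ x ^ d = (u.2 : Kˣ) * v.2

theorem NormVertex.adj_symm {K : Type*} [Field K] {d : ℕ} {u v : NormVertex K d}
    (h : u.Adj v) : v.Adj u := by
  obtain ⟨hne, x, hx, hxd⟩ := h
  exact ⟨hne.symm, x, by rw [hx, add_comm], by rw [hxd, mul_comm]⟩

section Codegree

variable {K : Type*} [Field K] [Fintype K] [DecidableEq K] (p : ℕ) [Fact p.Prime] [CharP K p]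

/-- Two norm equations with distinct shifts have at most two common solutions. -/
theorem card_filter_norm_eq_le {B₁ B₂ : K} (hB : B₁ ≠ B₂) (c₁ c₂ : K) :
    (Finset.univ.filter fun Y : K => (Y + B₁) ^ (p + 1) = c₁ ∧ (Y + B₂) ^ (p + 1) = c₂).card ≤ 2 := by
  have hB' : B₁ - B₂ ≠ 0 := sub_ne_zero.2 hB
  set α : K := (B₁ - B₂) ^ p / (B₁ - B₂)
  have hα : α ≠ 0 := div_ne_zero (pow_ne_zero _ hB') hB'
  have hexp (Y B : K) : (Y + B) ^ (p + 1) = (Y + B) * (Y ^ p + B ^ p) := by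
    rw [pow_succ', add_pow_expChar]
  have hsub : (B₁ - B₂) ^ p = B₁ ^ p - B₂ ^ p := sub_pow_expChar _ _
  -- Frobenius is additive, so subtracting the equations cancels Y * Y^p and expresses Y^p as an
  -- affine function of Y. Substituting back leaves a quadratic with leading coefficient ±α ≠ 0.
  obtain ⟨b, e, hquad⟩ : ∃ b e : K, ∀ Y : K, (Y + B₁) ^ (p + 1) = c₁ → (Y + B₂) ^ (p + 1) = c₂ →
      α * Y ^ 2 + b * Y + e = 0 := by
    set β : K := (c₁ - c₂ - (B₁ * B₁ ^ p - B₂ * B₂ ^ p)) / (B₁ - B₂)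
    refine ⟨α * B₁ - β - B₁ ^ p, c₁ - B₁ * (β + B₁ ^ p), fun Y h1 h2 => ?_⟩
    rw [hexp] at h1 h2
    have hY : Y ^ p = -(α * Y) + β := by
      simp only [α, β]
      rw [hsub]
      field_simp
      linear_combination h1 - h2
    rw [hY] at h1
    linear_combination -h1
  by_contra! h
  obtain ⟨x, hx, y, hy, z, hz, hxy, hxz, hyz⟩ := Finset.two_lt_card.1 h
  have key : ∀ w ∈ Finset.univ.filter fun Y : K =>
      (Y + B₁) ^ (p + 1) = c₁ ∧ (Y + B₂) ^ (p + 1) = c₂, α * w ^ 2 + b * w + e = 0 := fun w hw =>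
    hquad w (Finset.mem_filter.1 hw).2.1 (Finset.mem_filter.1 hw).2.2
  have hx' := key x hx
  have hy' := key y hy
  have hz' := key z hz
  have h1 : α * (x + y) + b = 0 := mul_left_cancel₀ (sub_ne_zero.2 hxy) (by
    linear_combination hx' - hy')
  have h2 : α * (x + z) + b = 0 := mul_left_cancel₀ (sub_ne_zero.2 hxz) (by
    linear_combination hx' - hz')
  exact mul_ne_zero hα (sub_ne_zero.2 hyz) (by linear_combination h1 - h2)

/-- Two power-of-norm equations with distinct shifts have few common solutions. -/
theorem card_filter_norm_pow_eq_le {r : ℕ} (hr : 0 < r) {B₁ B₂ : K} (hB : B₁ ≠ B₂) (γ₁ γ₂ : K) :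
    (Finset.univ.filter fun Y : K => (Y + B₁) ^ ((p + 1) * r) = γ₁ ∧
      (Y + B₂) ^ ((p + 1) * r) = γ₂).card ≤ 2 * r ^ 2 := by
  -- Taking r-th roots leaves at most r^2 pairs of norm values, each with at most two solutions.
  let Γ : K → Finset K := fun γ => (Polynomial.nthRoots r γ).toFinset
  have hΓ (γ : K) : (Γ γ).card ≤ r :=
    (Multiset.toFinset_card_le _).trans (Polynomial.card_nthRoots r γ)
  have hsub : (Finset.univ.filter fun Y : K => (Y + B₁) ^ ((p + 1) * r) = γ₁ ∧
      (Y + B₂) ^ ((p + 1) * r) = γ₂) ⊆ (Γ γ₁ ×ˢ Γ γ₂).biUnion fun c =>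
        Finset.univ.filter fun Y : K => (Y + B₁) ^ (p + 1) = c.1 ∧ (Y + B₂) ^ (p + 1) = c.2 := by
    intro Y hY
    obtain ⟨-, h1, h2⟩ := Finset.mem_filter.1 hY
    rw [pow_mul] at h1 h2
    refine Finset.mem_biUnion.2 ⟨((Y + B₁) ^ (p + 1), (Y + B₂) ^ (p + 1)), ?_, by simp⟩
    simp [Γ, Polynomial.mem_nthRoots hr, h1, h2]
  refine (Finset.card_le_card hsub).trans ((Finset.card_biUnion_le_card_mul _ _ 2 fun c _ =>
    card_filter_norm_eq_le p hB c.1 c.2).trans ?_)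
  rw [Finset.card_product]
  nlinarith [Nat.mul_le_mul (hΓ γ₁) (hΓ γ₂)]

/-- Three distinct vertices of the norm graph have at most `2 * r ^ 2` common neighbours. -/
theorem NormVertex.card_common_le {r : ℕ} (hr : 0 < r) {u v w : NormVertex K ((p + 1) * r)}
    (huv : u ≠ v) (huw : u ≠ w) (hvw : v ≠ w) {N : Finset (NormVertex K ((p + 1) * r))}
    (hN : ∀ z ∈ N, z.Adj u ∧ z.Adj v ∧ z.Adj w) : N.card ≤ 2 * r ^ 2 := by
  rcases N.eq_empty_or_nonempty with rfl | ⟨z₀, hz₀⟩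
  · simp
  -- For a fixed neighbour, the first coordinate determines the second.
  have hdist {x y z : NormVertex K ((p + 1) * r)} (hxy : x ≠ y) (h1 : z.Adj x) (h2 : z.Adj y) :
      x.1 ≠ y.1 := by
    intro h
    obtain ⟨-, a, ha, had⟩ := h1
    obtain ⟨-, b, hb, hbd⟩ := h2
    have hab : a = b := Units.ext (by rw [ha, hb, h])
    rw [← hab, had] at hbd
    exact hxy (Prod.ext h (Subtype.ext (mul_left_cancel hbd)))
  obtain ⟨h0u, h0v, h0w⟩ := hN z₀ hz₀
  have hAuv := hdist huv h0u h0v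
  have hAuw := sub_ne_zero.2 (hdist huw h0u h0w)
  have hAvw := sub_ne_zero.2 (hdist hvw h0v h0w)
  have hBne : (u.1 - w.1)⁻¹ ≠ (v.1 - w.1)⁻¹ := fun h => hAuv (sub_left_injective (inv_injective h))
  have hw0 : ((w.2 : Kˣ) : K) ≠ 0 := Units.ne_zero _
  -- Dividing the equation at x by the one at w eliminates `z.2`. In the variable Y = 1/(z.1 + w.1)
  -- the quotient becomes a shifted norm equation, with shift 1/(x.1 - w.1).
  have hsol {x z : NormVertex K ((p + 1) * r)} (hxw : x.1 - w.1 ≠ 0) (h1 : z.Adj x)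
      (h2 : z.Adj w) : ((z.1 + w.1)⁻¹ + (x.1 - w.1)⁻¹) ^ ((p + 1) * r) =
        ((x.2 : Kˣ) : K) / (w.2 : Kˣ) / (x.1 - w.1) ^ ((p + 1) * r) := by
    obtain ⟨-, a, ha, had⟩ := h1
    obtain ⟨-, b, hb, hbd⟩ := h2
    have hb0 : z.1 + w.1 ≠ 0 := hb ▸ b.ne_zero
    have had' : (z.1 + x.1) ^ ((p + 1) * r) = ((z.2 : Kˣ) : K) * (x.2 : Kˣ) := by
      rw [← ha]; exact_mod_cast congrArg Units.val had
    have hbd' : (z.1 + w.1) ^ ((p + 1) * r) = ((z.2 : Kˣ) : K) * (w.2 : Kˣ) := by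
      rw [← hb]; exact_mod_cast congrArg Units.val hbd
    have hz0 : ((z.2 : Kˣ) : K) ≠ 0 := Units.ne_zero _
    have hid : (z.1 + w.1)⁻¹ + (x.1 - w.1)⁻¹ = (z.1 + x.1) / (z.1 + w.1) / (x.1 - w.1) := by
      field_simp
      ring
    rw [hid, div_pow, div_pow, had', hbd']
    field_simp
  have hmaps : ∀ z ∈ N, (z.1 + w.1)⁻¹ ∈ Finset.univ.filter fun Y : K =>
      (Y + (u.1 - w.1)⁻¹) ^ ((p + 1) * r) =
        ((u.2 : Kˣ) : K) / (w.2 : Kˣ) / (u.1 - w.1) ^ ((p + 1) * r) ∧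
      (Y + (v.1 - w.1)⁻¹) ^ ((p + 1) * r) =
        ((v.2 : Kˣ) : K) / (w.2 : Kˣ) / (v.1 - w.1) ^ ((p + 1) * r) := fun z hz => by
    obtain ⟨h1, h2, h3⟩ := hN z hz
    exact Finset.mem_filter.2 ⟨Finset.mem_univ _, hsol hAuw h1 h3, hsol hAvw h2 h3⟩
  refine (Finset.card_le_card_of_injOn _ hmaps ?_).trans
    (card_filter_norm_pow_eq_le p hr hBne _ _)
  intro z hz z' hz' h
  have h1 : z.1 = z'.1 := add_right_cancel (inv_injective h)
  by_contra hne
  exact hdist hne (NormVertex.adj_symm (hN z hz).1) (NormVertex.adj_symm (hN z' hz').1) h1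

end Codegree

/-! ### Counting triangles of the norm graph. -/

/-- At most six ordered triples of distinct elements have the same underlying set. -/
theorem card_le_six_mul_card_image {V : Type*} [DecidableEq V] (T : Finset (V × V × V))
    (hT : ∀ q ∈ T, q.1 ≠ q.2.1 ∧ q.1 ≠ q.2.2 ∧ q.2.1 ≠ q.2.2) :
    T.card ≤ 6 * (T.image fun q => ({q.1, q.2.1, q.2.2} : Finset V)).card := by
  refine Finset.card_le_mul_card_image T 6 fun s hs => ?_
  obtain ⟨⟨x, y, z⟩, -, rfl⟩ := Finset.mem_image.1 hs
  refine (Finset.card_le_card (t := {(x, y, z), (x, z, y), (y, x, z), (y, z, x), (z, x, y),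
    (z, y, x)}) ?_).trans Finset.card_le_six
  rintro ⟨a, b, c⟩ hq
  obtain ⟨hqT, hq⟩ := Finset.mem_filter.1 hq
  obtain ⟨hab, hac, hbc⟩ := hT _ hqT
  have ha : a ∈ ({x, y, z} : Finset V) := hq ▸ by simp
  have hb : b ∈ ({x, y, z} : Finset V) := hq ▸ by simp
  have hc : c ∈ ({x, y, z} : Finset V) := hq ▸ by simp
  simp only [Finset.mem_insert, Finset.mem_singleton, Prod.mk.injEq] at *
  grind

theorem Finset.card_le_card_filter_not_or {α : Type*} (s : Finset α) {P Q R : α → Prop}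
    [DecidablePred P] [DecidablePred Q] [DecidablePred R]
    [DecidablePred fun q => ¬ (P q ∨ Q q ∨ R q)] {m : ℕ} (hP : (s.filter P).card ≤ m)
    (hQ : (s.filter Q).card ≤ m) (hR : (s.filter R).card ≤ m) :
    s.card ≤ (s.filter fun q => ¬ (P q ∨ Q q ∨ R q)).card + 3 * m := by
  classical
  have hsub : s ⊆ (s.filter fun q => ¬ (P q ∨ Q q ∨ R q)) ∪
      (s.filter P ∪ (s.filter Q ∪ s.filter R)) := fun q hq => by
    simp only [Finset.mem_union, Finset.mem_filter]
    tauto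
  have h := Finset.card_le_card hsub
  have h1 := Finset.card_union_le (s.filter fun q => ¬ (P q ∨ Q q ∨ R q))
    (s.filter P ∪ (s.filter Q ∪ s.filter R))
  have h2 := Finset.card_union_le (s.filter P) (s.filter Q ∪ s.filter R)
  have h3 := Finset.card_union_le (s.filter Q) (s.filter R)
  omega

/-- The norm graph on a field with `D` units, of characteristic not two, has at least
`D ^ 3 - 3 * D ^ 2` ordered triangles. -/
theorem NormVertex.exists_triangles {K : Type*} [Field K] [Fintype K]
    (h2 : (2 : K) ≠ 0) (d : ℕ) :
    ∃ T : Finset (NormVertex K d × NormVertex K d × NormVertex K d),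
      (∀ q ∈ T, q.1.Adj q.2.1 ∧ q.1.Adj q.2.2 ∧ q.2.1.Adj q.2.2) ∧
      Nat.card Kˣ ^ 3 ≤ T.card + 3 * Nat.card Kˣ ^ 2 := by
  classical
  let R := (powMonoidHom d : Kˣ →* Kˣ).range
  let Q := (powMonoidHom d : Kˣ →* Kˣ).ker
  have hD : Fintype.card R * Fintype.card Q = Nat.card Kˣ := by
    rw [← Nat.card_eq_fintype_card, ← Nat.card_eq_fintype_card, mul_comm]
    have := (powMonoidHom d : Kˣ →* Kˣ).ker.card_mul_index
    rwa [Subgroup.index_ker] at this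
  -- `σ s` is one d-th root of s; all others are `σ s * x` with x in the kernel Q. Triples in R^3 ×
  -- Q^3 thus parametrise second coordinates together with the three edge sums X, Y, Z, giving D^3
  -- choices.
  let σ : R → Kˣ := fun s => s.2.choose
  have hσ (s : R) : σ s ^ d = s := s.2.choose_spec
  have hQ (x : Q) : (x : Kˣ) ^ d = 1 := x.2
  have hcancel {s : R} {x y : Q} (h : ((σ s * x : Kˣ) : K) = (σ s * y : Kˣ)) : x = y :=
    Subtype.ext (mul_left_cancel (Units.ext h))
  let X : (R × R × R) × Q × Q × Q → Kˣ := fun q => σ (q.1.1 * q.1.2.1) * q.2.1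
  let Y : (R × R × R) × Q × Q × Q → Kˣ := fun q => σ (q.1.1 * q.1.2.2) * q.2.2.1
  let Z : (R × R × R) × Q × Q × Q → Kˣ := fun q => σ (q.1.2.1 * q.1.2.2) * q.2.2.2
  have hX (q) : X q ^ d = q.1.1 * q.1.2.1 := by simp [X, mul_pow, hσ, hQ]
  have hY (q) : Y q ^ d = q.1.1 * q.1.2.2 := by simp [Y, mul_pow, hσ, hQ]
  have hZ (q) : Z q ^ d = q.1.2.1 * q.1.2.2 := by simp [Z, mul_pow, hσ, hQ]
  -- The first coordinates solve A + B = X, A + C = Y, B + C = Z, which requires dividing by 2.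
  let v₁ : (R × R × R) × Q × Q × Q → NormVertex K d := fun q => ((X q + Y q - Z q) / 2, q.1.1)
  let v₂ : (R × R × R) × Q × Q × Q → NormVertex K d := fun q => ((X q + Z q - Y q) / 2, q.1.2.1)
  let v₃ : (R × R × R) × Q × Q × Q → NormVertex K d := fun q => ((Y q + Z q - X q) / 2, q.1.2.2)
  let ψ : (R × R × R) × Q × Q × Q → NormVertex K d × NormVertex K d × NormVertex K d :=
    fun q => (v₁ q, v₂ q, v₃ q)
  have hinj : Function.Injective ψ := by
    rintro ⟨⟨a, b, c⟩, x, y, z⟩ ⟨⟨a', b', c'⟩, x', y', z'⟩ h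
    simp only [Prod.mk.injEq, ψ, v₁, v₂, v₃] at h
    obtain ⟨⟨h1, rfl⟩, ⟨h2', rfl⟩, ⟨h3, rfl⟩⟩ := h
    field_simp at h1 h2' h3
    have hx : x = x' := hcancel (s := a * b) (mul_left_cancel₀ h2 (by
      simp only [X, Y, Z] at h1 h2' h3 ⊢
      linear_combination h1 + h2'))
    have hy : y = y' := hcancel (s := a * c) (mul_left_cancel₀ h2 (by
      simp only [X, Y, Z] at h1 h2' h3 ⊢
      linear_combination h1 + h3))
    have hz : z = z' := hcancel (s := b * c) (mul_left_cancel₀ h2 (by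
      simp only [X, Y, Z] at h1 h2' h3 ⊢
      linear_combination h2' + h3))
    rw [hx, hy, hz]
  let good := Finset.univ.filter fun q => ¬ (v₁ q = v₂ q ∨ v₁ q = v₃ q ∨ v₂ q = v₃ q)
  have hcard2 : (Finset.univ : Finset ((R × R) × Q × Q)).card = Nat.card Kˣ ^ 2 := by
    rw [Finset.card_univ, Fintype.card_prod, Fintype.card_prod, Fintype.card_prod, ← hD]
    ring
  have hcard3 : (Finset.univ : Finset ((R × R × R) × Q × Q × Q)).card = Nat.card Kˣ ^ 3 := by
    simp only [Finset.card_univ, Fintype.card_prod, ← hD]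
    ring
  -- The coincidence v₁ = v₂ forces a = b and Y = Z, so one parameter from R and one from Q are
  -- lost.
  have h12 : (Finset.univ.filter fun q => v₁ q = v₂ q).card ≤ Nat.card Kˣ ^ 2 := by
    rw [← hcard2]
    refine Finset.card_le_card_of_injOn (fun q => ((q.1.1, q.1.2.2), q.2.1, q.2.2.1))
      (fun _ _ => Finset.mem_coe.2 (Finset.mem_univ _)) ?_
    have key : ∀ a b c x y z, v₁ ((a, b, c), x, y, z) = v₂ ((a, b, c), x, y, z) →
        a = b ∧ y = z := by
      intro a b c x y z h
      simp only [v₁, v₂, Prod.mk.injEq] at h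
      obtain ⟨h, rfl⟩ := h
      field_simp at h
      refine ⟨rfl, hcancel (s := a * c) (mul_left_cancel₀ h2 ?_)⟩
      simp only [X, Y, Z] at h
      linear_combination h
    rintro ⟨⟨a, b, c⟩, x, y, z⟩ hq ⟨⟨a', b', c'⟩, x', y', z'⟩ hq' h
    obtain ⟨rfl, rfl⟩ := key _ _ _ _ _ _ (Finset.mem_filter.1 hq).2
    obtain ⟨rfl, rfl⟩ := key _ _ _ _ _ _ (Finset.mem_filter.1 hq').2
    simp only [Prod.mk.injEq] at h ⊢
    tauto
  have h13 : (Finset.univ.filter fun q => v₁ q = v₃ q).card ≤ Nat.card Kˣ ^ 2 := by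
    rw [← hcard2]
    refine Finset.card_le_card_of_injOn (fun q => ((q.1.1, q.1.2.1), q.2.1, q.2.2.1))
      (fun _ _ => Finset.mem_coe.2 (Finset.mem_univ _)) ?_
    have key : ∀ a b c x y z, v₁ ((a, b, c), x, y, z) = v₃ ((a, b, c), x, y, z) →
        a = c ∧ x = z := by
      intro a b c x y z h
      simp only [v₁, v₃, Prod.mk.injEq] at h
      obtain ⟨h, rfl⟩ := h
      field_simp at h
      refine ⟨rfl, hcancel (s := a * b) (mul_left_cancel₀ h2 ?_)⟩
      simp only [X, Y, Z, mul_comm b a] at h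
      linear_combination h
    rintro ⟨⟨a, b, c⟩, x, y, z⟩ hq ⟨⟨a', b', c'⟩, x', y', z'⟩ hq' h
    obtain ⟨rfl, rfl⟩ := key _ _ _ _ _ _ (Finset.mem_filter.1 hq).2
    obtain ⟨rfl, rfl⟩ := key _ _ _ _ _ _ (Finset.mem_filter.1 hq').2
    simp only [Prod.mk.injEq] at h ⊢
    tauto
  have h23 : (Finset.univ.filter fun q => v₂ q = v₃ q).card ≤ Nat.card Kˣ ^ 2 := by
    rw [← hcard2]
    refine Finset.card_le_card_of_injOn (fun q => ((q.1.1, q.1.2.1), q.2.1, q.2.2.2))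
      (fun _ _ => Finset.mem_coe.2 (Finset.mem_univ _)) ?_
    have key : ∀ a b c x y z, v₂ ((a, b, c), x, y, z) = v₃ ((a, b, c), x, y, z) →
        b = c ∧ x = y := by
      intro a b c x y z h
      simp only [v₂, v₃, Prod.mk.injEq] at h
      obtain ⟨h, rfl⟩ := h
      field_simp at h
      refine ⟨rfl, hcancel (s := a * b) (mul_left_cancel₀ h2 ?_)⟩
      simp only [X, Y, Z] at h
      linear_combination h
    rintro ⟨⟨a, b, c⟩, x, y, z⟩ hq ⟨⟨a', b', c'⟩, x', y', z'⟩ hq' h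
    obtain ⟨rfl, rfl⟩ := key _ _ _ _ _ _ (Finset.mem_filter.1 hq).2
    obtain ⟨rfl, rfl⟩ := key _ _ _ _ _ _ (Finset.mem_filter.1 hq').2
    simp only [Prod.mk.injEq] at h ⊢
    tauto
  have hgood := Finset.card_le_card_filter_not_or _ h12 h13 h23
  refine ⟨good.image ψ, fun q hq => ?_, ?_⟩
  · obtain ⟨q, hgq, rfl⟩ := Finset.mem_image.1 hq
    have hne : ¬ (v₁ q = v₂ q ∨ v₁ q = v₃ q ∨ v₂ q = v₃ q) := by
      exact (Finset.mem_filter.1 hgq).2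
    have hA₁ : (X q : K) = (v₁ q).1 + (v₂ q).1 := by simp only [v₁, v₂]; field_simp; ring
    have hA₂ : (Y q : K) = (v₁ q).1 + (v₃ q).1 := by simp only [v₁, v₃]; field_simp; ring
    have hA₃ : (Z q : K) = (v₂ q).1 + (v₃ q).1 := by simp only [v₂, v₃]; field_simp; ring
    exact ⟨⟨fun h => hne (Or.inl h), X q, hA₁, hX q⟩,
      ⟨fun h => hne (Or.inr (Or.inl h)), Y q, hA₂, hY q⟩,
      ⟨fun h => hne (Or.inr (Or.inr h)), Z q, hA₃, hZ q⟩⟩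
  · have himg : (good.image ψ).card = good.card := Finset.card_image_of_injective good hinj
    rw [himg, ← hcard3]
    exact hgood

/-! ### From the norm graph to the Turán number. -/

/-- If `F` has no isolated vertices, then a copy of `F` in an embedded hypergraph comes from a copy
in the original hypergraph. -/
theorem ContainsCopy.of_map {W V U : Type*} {F : Finset (Finset W)} {H : Finset (Finset V)}
    (hF : ∀ w, ∃ e ∈ F, w ∈ e) (ι : V ↪ U)
    (h : ContainsCopy F (H.map (Finset.mapEmbedding ι).toEmbedding)) : ContainsCopy F H := by
  obtain ⟨f, hf⟩ := h
  have hpre : ∀ w, ∃ v, ι v = f w := by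
    intro w
    obtain ⟨e, he, hw⟩ := hF w
    obtain ⟨s, -, hse⟩ := Finset.mem_map.1 (hf e he)
    have hmem : f w ∈ e.map f := Finset.mem_map_of_mem f hw
    rw [← hse] at hmem
    obtain ⟨v, -, hv⟩ := Finset.mem_map.1 hmem
    exact ⟨v, hv⟩
  choose g hg using hpre
  have hinj : Function.Injective g := fun a b hab => f.injective (by rw [← hg, ← hg, hab])
  refine ⟨⟨g, hinj⟩, fun e he => ?_⟩
  have hfg : f = (⟨g, hinj⟩ : W ↪ V).trans ι := by
    ext w
    exact (hg w).symm
  obtain ⟨s, hs, hse⟩ := Finset.mem_map.1 (hf e he)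
  rw [hfg, ← Finset.map_map] at hse
  have : s = e.map ⟨g, hinj⟩ := Finset.map_injective ι hse
  rwa [← this]

theorem exists_mem_graphExpansion {W : Type*} [Fintype W] {G : SimpleGraph W}
    (hG : ∀ u, ∃ v, G.Adj u v) (w : W ⊕ G.edgeSet) : ∃ e ∈ graphExpansion G, w ∈ e := by
  classical
  unfold graphExpansion
  rcases w with u | e
  · obtain ⟨v, huv⟩ := hG u
    exact ⟨_, Finset.mem_image_of_mem _ (Finset.mem_univ ⟨s(u, v), huv⟩), by simp⟩
  · exact ⟨_, Finset.mem_image_of_mem _ (Finset.mem_univ e), by simp⟩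

/-- Distinct vertices of an edge of `G` lie in a common edge of any copy of the expansion. -/
theorem exists_edge_of_adj {W V : Type*} [Fintype W] {G : SimpleGraph W} {H : Finset (Finset V)}
    {f : W ⊕ G.edgeSet ↪ V} (hf : ∀ e ∈ graphExpansion G, e.map f ∈ H) {u v : W}
    (huv : G.Adj u v) : ∃ s ∈ H, f (Sum.inl u) ∈ s ∧ f (Sum.inl v) ∈ s := by
  classical
  unfold graphExpansion at hf
  refine ⟨_, hf _ (Finset.mem_image_of_mem _ (Finset.mem_univ ⟨s(u, v), huv⟩)), ?_, ?_⟩ <;>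
  · refine Finset.mem_map_of_mem f ?_
    simp

/-- When every edge of H is a clique of R, a copy of the expansion contains a K_{3,t} in R: its
t-side is a set of t common neighbours of three vertices. -/
theorem not_containsCopy_graphExpansion {V : Type*} {R : V → V → Prop} {H : Finset (Finset V)}
    (hH : ∀ s ∈ H, ∀ u ∈ s, ∀ v ∈ s, u ≠ v → R u v) {t : ℕ}
    (hcod : ∀ a b c, a ≠ b → a ≠ c → b ≠ c → ∀ N : Finset V,
      (∀ v ∈ N, R v a ∧ R v b ∧ R v c) → N.card < t) :
    ¬ ContainsCopy (graphExpansion (completeBipartiteGraph (Fin 3) (Fin t))) H := by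
  rintro ⟨f, hf⟩
  have hR (i : Fin 3) (j : Fin t) : R (f (.inl (.inr j))) (f (.inl (.inl i))) := by
    obtain ⟨s, hs, h1, h2⟩ := exists_edge_of_adj hf (u := .inr j) (v := .inl i) (by simp)
    exact hH s hs _ h1 _ h2 fun h => by simpa using f.injective h
  have hne (i j : Fin 3) (hij : i ≠ j) : f (.inl (.inl i)) ≠ f (.inl (.inl j)) := fun h => by
    simpa [hij] using f.injective h
  let e : Fin t ↪ V := ⟨fun j => f (.inl (.inr j)), fun i j h => by simpa using f.injective h⟩
  have h := hcod _ _ _ (hne 0 1 (by decide)) (hne 0 2 (by decide)) (hne 1 2 (by decide))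
    (Finset.univ.map e) (fun v hv => by
      obtain ⟨j, -, rfl⟩ := Finset.mem_map.1 hv
      exact ⟨hR 0 j, hR 1 j, hR 2 j⟩)
  simp at h

/-- The unit group is cyclic of order p^2 - 1 = (p+1)rm, so its (p+1)r-th powers form a subgroup of
order m. -/
theorem natCard_normVertex {K : Type*} [Field K] [Finite K] {p r m : ℕ} (hp : 1 ≤ p)
    (hr : 0 < r) (hm : r * m = p - 1) (hK : Nat.card K = p ^ 2) :
    Nat.card (NormVertex K ((p + 1) * r)) = p ^ 2 * m := by
  have hunits : Nat.card Kˣ = (p + 1) * r * m := by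
    rw [Nat.card_units, hK, mul_assoc, hm, ← Nat.sq_sub_sq, one_pow]
  rw [Nat.card_prod, hK, IsCyclic.card_powMonoidHom_range, hunits,
    Nat.gcd_eq_right (Dvd.intro _ rfl), Nat.mul_div_cancel_left _ (by positivity)]

/-- The triangles of the norm graph over the field with `p ^ 2` elements give a lower bound for the
Turán number of the expansion of `K_{3, 2 r ^ 2 + 1}`. -/
theorem le_turanNumber_of_prime {p r m n : ℕ} (hp : p.Prime) (hp2 : p ≠ 2) (hr : 0 < r)
    (hm : r * m = p - 1) (hn : p ^ 2 * m ≤ n) :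
    (p ^ 2 - 1) ^ 3 ≤ 6 * turanNumber 3 n
      (graphExpansion (completeBipartiteGraph (Fin 3) (Fin (2 * r ^ 2 + 1)))) +
        3 * (p ^ 2 - 1) ^ 2 := by
  classical
  have : Fact p.Prime := ⟨hp⟩
  let K := GaloisField p 2
  have : Fintype K := Fintype.ofFinite K
  have hK : Nat.card K = p ^ 2 := GaloisField.card p 2 two_ne_zero
  have h2 : (2 : K) ≠ 0 := by
    intro h
    have : ((2 : ℕ) : K) = 0 := by exact_mod_cast h
    rw [CharP.cast_eq_zero_iff K p, Nat.prime_dvd_prime_iff_eq hp Nat.prime_two] at this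
    exact hp2 this
  let V := NormVertex K ((p + 1) * r)
  have hV : Nat.card V = p ^ 2 * m := natCard_normVertex hp.one_le hr hm hK
  obtain ⟨T, hT, hTcard⟩ := NormVertex.exists_triangles h2 ((p + 1) * r)
  have hTne : ∀ q ∈ T, q.1 ≠ q.2.1 ∧ q.1 ≠ q.2.2 ∧ q.2.1 ≠ q.2.2 := fun q hq =>
    ⟨(hT q hq).1.1, (hT q hq).2.1.1, (hT q hq).2.2.1⟩
  let H : Finset (Finset V) := T.image fun q => {q.1, q.2.1, q.2.2}
  have hH3 : (H : Set (Finset V)).Sized 3 := by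
    intro s hs
    obtain ⟨q, hq, rfl⟩ := Finset.mem_image.1 (Finset.mem_coe.1 hs)
    exact Finset.card_eq_three.2 ⟨_, _, _, (hTne q hq).1, (hTne q hq).2.1, (hTne q hq).2.2, rfl⟩
  have hHadj : ∀ s ∈ H, ∀ u ∈ s, ∀ v ∈ s, u ≠ v → NormVertex.Adj u v := by
    intro s hs u hu v hv huv
    obtain ⟨q, hq, rfl⟩ := Finset.mem_image.1 hs
    obtain ⟨h12, h13, h23⟩ := hT q hq
    simp only [Finset.mem_insert, Finset.mem_singleton] at hu hv
    rcases hu with rfl | rfl | rfl <;> rcases hv with rfl | rfl | rfl <;>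
      first
      | exact absurd rfl huv
      | assumption
      | exact NormVertex.adj_symm (by assumption)
  have hfree := not_containsCopy_graphExpansion (t := 2 * r ^ 2 + 1) hHadj
    fun a b c hab hac hbc N hN =>
      Nat.lt_succ_of_le (NormVertex.card_common_le p hr hab hac hbc hN)
  have : Fintype V := Fintype.ofFinite V
  -- The vertices of `Fin n` outside the image are isolated. As the expansion has no isolated
  -- vertices, this padding creates no copy.
  obtain ⟨ι⟩ : Nonempty (V ↪ Fin n) := Function.Embedding.nonempty_of_card_le (by
    rw [Fintype.card_fin, ← Nat.card_eq_fintype_card, hV]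
    exact hn)
  have hle := le_turanNumber (k := 3) (H := H.map (Finset.mapEmbedding ι).toEmbedding)
    (fun s hs => by
      obtain ⟨s', hs', rfl⟩ := Finset.mem_map.1 (Finset.mem_coe.1 hs)
      exact (Finset.card_map ι).trans (hH3 hs'))
    (fun h => hfree (h.of_map (exists_mem_graphExpansion (by
      rintro (i | j)
      · exact ⟨.inr 0, by simp⟩
      · exact ⟨.inl 0, by simp⟩)) ι))
  rw [Finset.card_map] at hle
  have h6 := card_le_six_mul_card_image T hTne
  rw [Nat.card_units, hK] at hTcard
  calc _ ≤ T.card + 3 * (p ^ 2 - 1) ^ 2 := hTcard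
    _ ≤ 6 * H.card + 3 * (p ^ 2 - 1) ^ 2 := Nat.add_le_add_right h6 _
    _ ≤ _ := by gcongr

/-! ### Choice of the prime and the asymptotics. -/

theorem eventually_le_turanNumber {r : ℕ} (hr : 1 ≤ r) {ε : ℝ} (hε : 0 < ε) (hε1 : ε ≤ 1) :
    ∀ᶠ n : ℕ in atTop, (1 - ε) * ((r : ℝ) ^ 2 / 6) * (n : ℝ) ^ 2 ≤ (turanNumber 3 n
      (graphExpansion (completeBipartiteGraph (Fin 3) (Fin (2 * r ^ 2 + 1)))) : ℝ) := by
  have : NeZero r := ⟨by omega⟩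
  have hr0 : (0 : ℝ) < r := by exact_mod_cast hr
  -- With log p within δ of log(rn)/3 - δ, one gets exp(-6δ) rn ≤ p^3 ≤ rn. Squaring loses exp(-12δ)
  -- ≥ 1 - ε/2; the other ε/2 absorbs 6p^4 via p > 12/ε.
  set δ : ℝ := ε / 24 with hδ
  have hlog : Tendsto (fun n : ℕ => Real.log (r * n) / 3 - δ) atTop atTop :=
    tendsto_atTop_add_const_right _ _ ((Real.tendsto_log_atTop.comp
      (tendsto_natCast_atTop_atTop.const_mul_atTop hr0)).atTop_div_const (by norm_num))
  have hprime := hlog.eventually (eventually_exists_prime_eq_mod (q := r) (a := 1) isUnit_one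
    (show 0 < δ by positivity))
  filter_upwards [hprime, hlog.eventually_gt_atTop (Real.log (12 / ε) + δ),
    eventually_gt_atTop 0] with n hn hbig hn0
  obtain ⟨p, hp, hpr, hpy⟩ := hn
  have hrn : (0 : ℝ) < r * n := by positivity
  have hp0 : (0 : ℝ) < p := by exact_mod_cast hp.pos
  rw [abs_le] at hpy
  have hp12 : 12 / ε < p := by
    rw [← Real.log_lt_log_iff (by positivity) hp0]
    linarith [hpy.2]
  have hp12' : (12 : ℝ) < p := lt_of_le_of_lt (by rw [le_div_iff₀ hε]; linarith) hp12
  have hup : (p : ℝ) ^ 3 ≤ r * n := by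
    rw [← Real.log_le_log_iff (by positivity) hrn, Real.log_pow]
    push_cast
    linarith [hpy.1]
  have hlow : Real.exp (-(6 * δ)) * (r * n) ≤ (p : ℝ) ^ 3 := by
    rw [← Real.log_le_log_iff (by positivity) (by positivity), Real.log_pow,
      Real.log_mul (Real.exp_pos _).ne' hrn.ne', Real.log_exp]
    push_cast
    linarith [hpy.2]
  obtain ⟨m, hm⟩ : r ∣ p - 1 := by
    rw [← ZMod.natCast_eq_zero_iff, Nat.cast_sub hp.one_le, hpr, Nat.cast_one, sub_self]
  have hmn : p ^ 2 * m ≤ n := by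
    have h1 : r * (p ^ 2 * m) ≤ r * n := by
      have h2 : p ^ 3 ≤ r * n := by exact_mod_cast hup
      calc r * (p ^ 2 * m) = p ^ 2 * (p - 1) := by rw [hm]; ring
        _ ≤ p ^ 2 * p := Nat.mul_le_mul_left _ (Nat.sub_le _ _)
        _ = p ^ 3 := by ring
        _ ≤ r * n := h2
    exact Nat.le_of_mul_le_mul_left h1 hr
  have hp2 : p ≠ 2 := by
    rintro rfl
    norm_num at hp12'
  have hT := le_turanNumber_of_prime hp hp2 hr hm.symm hmn
  set τ := turanNumber 3 n
      (graphExpansion (completeBipartiteGraph (Fin 3) (Fin (2 * r ^ 2 + 1))))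
  have hT' : ((p : ℝ) ^ 2 - 1) ^ 3 ≤ 6 * τ + 3 * ((p : ℝ) ^ 2 - 1) ^ 2 := by
    have h1 : ((p ^ 2 - 1 : ℕ) : ℝ) = (p : ℝ) ^ 2 - 1 := by
      rw [Nat.cast_sub (Nat.one_le_pow _ _ hp.pos)]
      push_cast
      rfl
    rw [← h1]
    exact_mod_cast hT
  have hmain : (p : ℝ) ^ 6 - 6 * (p : ℝ) ^ 4 ≤ 6 * τ := by nlinarith
  have hsmall : 6 * (p : ℝ) ^ 4 ≤ ε / 2 * (p : ℝ) ^ 6 := by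
    rw [div_lt_iff₀ hε] at hp12
    have : 6 ≤ ε / 2 * (p : ℝ) ^ 2 := by nlinarith
    calc 6 * (p : ℝ) ^ 4 ≤ ε / 2 * (p : ℝ) ^ 2 * (p : ℝ) ^ 4 := by gcongr
      _ = _ := by ring
  have hlow2 : (1 - ε / 2) * (r * n) ^ 2 ≤ (p : ℝ) ^ 6 := by
    calc (1 - ε / 2) * ((r : ℝ) * n) ^ 2 ≤ Real.exp (-(12 * δ)) * (r * n) ^ 2 := by
          gcongr
          have := Real.add_one_le_exp (-(12 * δ))
          rw [hδ] at this ⊢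
          linarith
      _ = (Real.exp (-(6 * δ)) * (r * n)) ^ 2 := by
          rw [mul_pow (Real.exp _), ← Real.exp_nat_mul]
          congr 2
          push_cast
          ring
      _ ≤ ((p : ℝ) ^ 3) ^ 2 := by gcongr
      _ = _ := by ring
  have hfin : (1 - ε / 2) * ((1 - ε / 2) * ((r : ℝ) * n) ^ 2) ≤ 6 * τ :=
    (mul_le_mul_of_nonneg_left hlow2 (by linarith)).trans (by linarith)
  have hsq : (1 - ε) * ((r : ℝ) * n) ^ 2 ≤ (1 - ε / 2) * ((1 - ε / 2) * ((r : ℝ) * n) ^ 2) := by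
    nlinarith [mul_nonneg (sq_nonneg ε) (sq_nonneg ((r : ℝ) * n))]
  linarith [show (1 - ε) * ((r : ℝ) ^ 2 / 6) * (n : ℝ) ^ 2 = (1 - ε) * ((r : ℝ) * n) ^ 2 / 6 by ring]

/-- Reformulation of an asymptotic lower bound with an explicit error function. -/
theorem exists_tendsto_zero_of_eventually_le {f g : ℕ → ℝ} (hf : ∀ n, 0 ≤ f n) (hg : ∀ n, 0 ≤ g n)
    (hpos : ∀ᶠ n in atTop, 0 < g n)
    (h : ∀ ε : ℝ, 0 < ε → ε ≤ 1 → ∀ᶠ n in atTop, (1 - ε) * g n ≤ f n) :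
    ∃ ε : ℕ → ℝ, Tendsto ε atTop (𝓝 0) ∧ ∀ n, (1 - ε n) * g n ≤ f n := by
  refine ⟨fun n => max 0 (1 - f n / g n), ?_, fun n => ?_⟩
  · refine Metric.tendsto_nhds.2 fun e he => ?_
    filter_upwards [hpos, h (min (e / 2) 1) (by positivity) (min_le_right _ _)] with n hgn hn
    rw [← le_div_iff₀ hgn] at hn
    rw [Real.dist_eq, sub_zero, abs_of_nonneg (le_max_left _ _)]
    refine max_lt he ?_
    linarith [min_le_left (e / 2) 1]
  · rcases (hg n).eq_or_lt with h0 | h0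
    · rw [← h0, mul_zero]
      exact hf n
    · rw [← le_div_iff₀ h0]
      linarith [le_max_right 0 (1 - f n / g n)]

theorem mainTheorem4 (r t : ℕ) (hr : 1 ≤ r) (ht : t = 2 * r ^ 2 + 1) :
    (∃ ε : ℕ → ℝ, Tendsto ε atTop (𝓝 0) ∧
      ∀ n : ℕ, (1 - ε n) * (((t : ℝ) - 1) / 12) * (n : ℝ) ^ 2 ≤
        (turanNumber 3 n (graphExpansion (completeBipartiteGraph (Fin 3) (Fin t))) : ℝ)) ∧
    (fun n : ℕ =>
      (turanNumber 3 n (graphExpansion (completeBipartiteGraph (Fin 3) (Fin t))) : ℝ))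
      =O[atTop] (fun n : ℕ => (n : ℝ) ^ 2) := by
  refine ⟨?_, turanNumber_graphExpansion_isBigO t⟩
  subst ht
  have hc : (((2 * r ^ 2 + 1 : ℕ) : ℝ) - 1) / 12 = (r : ℝ) ^ 2 / 6 := by
    push_cast
    ring
  simp only [hc, mul_assoc]
  refine exists_tendsto_zero_of_eventually_le (fun n => Nat.cast_nonneg _)
    (fun n => by positivity) ?_ fun ε hε hε1 => ?_
  · filter_upwards [eventually_gt_atTop 0] with n hn
    have : (0 : ℝ) < r := by exact_mod_cast hr
    positivity
  · simpa only [mul_assoc] using eventually_le_turanNumber hr hε hε1
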